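/- For a sequence of positive integers $\mathbf{k}=(k_1,\dots,k_r)$ and an integer $n\ge 0$ put $$t_n(\mathbf{k})=\sum_{n\ge n_1>n_2>\cdots>n_r>0}\ \prod_{j=1}^r\frac{1}{(2n_j-1)^{k_j}},\qquad t^\star_n(\mathbf{k})=\sum_{n\ge n_1\ge n_2\ge\cdots\ge n_r>0}\ \prod_{j=1}^r\frac{1}{(2n_j-1)^{k_j}},$$ with $t_n(\emptyset)=t_n^\star(\emptyset)=1$, and let $1_d$ denote the sequence of $d$ ones. For $s_1\ge 2$ let $t(\mathbf{s})=\lim_{n\to\infty}t_n(\mathbf{s})$ be the multiple $t$-value, and write $|\mathbf{s}|=s_1+\cdots+s_d$ for the weight. Let $\mathrm{MtV}_w\subset\mathbb{R}$ be the $\mathbb{Q}$-span of all multiple $t$-values $t(\mathbf{s})$ with $s_1\ge2$ and $|\mathbf{s}|=w$. Let $\mathrm{CMZV}^N_w\subset\mathbb{C}$ be the $\mathbb{Q}$-span of all colored multiple zeta values of level $N$ and weight $w$, that is, of all $$\mathrm{Li}_{\mathbf{k}}(\mathbf{z})=\sum_{n_1>\cdots>n_r>0}\frac{z_1^{n_1}\cdots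 z_r^{n_r}}{n_1^{k_1}\cdots n_r^{k_r}}=\lim_{n\to\infty}\ \sum_{n\ge n_1>\cdots>n_r>0}\frac{z_1^{n_1}\cdots z_r^{n_r}}{n_1^{k_1}\cdots n_r^{k_r}}$$ with positive integers $k_j$, $|\mathbf{k}|=w$, $z_j^N=1$ for all $j$, and $(k_1,z_1)\ne(1,1)$. Then for every integer $m\ge 0$ all the series and limits below converge, and $$\sum_{n=0}^\infty \frac{1}{4^n}\binom{2n}{n}\frac{t^\star_{n+1}(1_m)}{2n+1}=\frac4\pi\sum_{k=0}^m\sum_{n=0}^\infty\frac{t_n(1_k)\,t^\star_{n+1}(1_{m-k})}{(2n+1)^2}=\frac4\pi\sum_{d=1}^{m+1}\ \sum_{\substack{\mathbf{s}=(s_1,\dots,s_d)\in\mathbb{N}^d\\ |\mathbf{s}|=m+2,\ s_1\ge2}}2^{d-1}\,t(\mathbf{s}),$$ where $\mathbb{N}$ denotes the positive integers. This common value lies in $\frac1\pi\mathrm{MtV}_{m+2}$, and $\frac1\pi\mathrm{MtV}_{m+2}\subset\frac1\pi\mathrm{CMZV}^2_{m+2}$. -/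

import Mathlib

open Filter Topology
open scoped Pointwise

noncomputable section

/-- The multiple `t`-harmonic sum
`t_n(k₁,…,k_r) = ∑_{n ≥ n₁ > n₂ > ⋯ > n_r > 0} ∏ⱼ 1 / (2 nⱼ - 1)^{kⱼ}`, as an iterated sum
(outermost index `n₁`, the next index satisfying `n₂ ≤ n₁ - 1`); `t_n(∅) = 1`. -/
def tSum : List ℕ → ℕ → ℝ
  | [], _ => 1
  | k :: ks, n => ∑ j ∈ Finset.Icc 1 n, 1 / (2 * (j : ℝ) - 1) ^ k * tSum ks (j - 1)

/-- The multiple `t`-harmonic star sum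
`t⋆_n(k₁,…,k_r) = ∑_{n ≥ n₁ ≥ n₂ ≥ ⋯ ≥ n_r > 0} ∏ⱼ 1 / (2 nⱼ - 1)^{kⱼ}`, as an iterated sum;
`t⋆_n(∅) = 1`. -/
def tStarSum : List ℕ → ℕ → ℝ
  | [], _ => 1
  | k :: ks, n => ∑ j ∈ Finset.Icc 1 n, 1 / (2 * (j : ℝ) - 1) ^ k * tStarSum ks j

/-- The sequence `1_d = (1,…,1)` with `d` repetitions. -/
def ones (d : ℕ) : List ℕ := List.replicate d 1

/-- A composition `(s₁,…,s_d)` is admissible if its first part satisfies `s₁ ≥ 2`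
(the empty composition is admissible). -/
abbrev AdmissibleIndex (s : List ℕ) : Prop := ∀ a ∈ s.head?, 2 ≤ a

/-- The multiple `t`-value `t(s) = lim_{n → ∞} t_n(s)`. -/
def tValue (s : List ℕ) : ℝ := limUnder atTop (tSum s)

/-- The `ℚ`-span of all multiple `t`-values of weight `w`. -/
def MtV (w : ℕ) : Submodule ℚ ℝ :=
  Submodule.span ℚ {x | ∃ s : Composition w, AdmissibleIndex s.blocks ∧
    Tendsto (tSum s.blocks) atTop (𝓝 x)}

/-- The truncated colored multiple zeta sum
`∑_{n ≥ n₁ > ⋯ > n_r > 0} z₁^{n₁} ⋯ z_r^{n_r} / (n₁^{k₁} ⋯ n_r^{k_r})`, as an iterated sum,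
for the list of pairs `(k₁, z₁), …, (k_r, z_r)`. -/
def coloredSum : List (ℕ × ℂ) → ℕ → ℂ
  | [], _ => 1
  | p :: ps, n => ∑ j ∈ Finset.Icc 1 n, p.2 ^ j / (j : ℂ) ^ p.1 * coloredSum ps (j - 1)

/-- The `ℚ`-span of all colored multiple zeta values `Li_k(z)` of level `N` and weight `w`:
all `k_j` are positive with sum `w`, all `z_j` are `N`-th roots of unity,
and `(k₁, z₁) ≠ (1, 1)`. -/
def CMZV (N w : ℕ) : Submodule ℚ ℂ :=
  Submodule.span ℚ {x | ∃ l : List (ℕ × ℂ), (∀ p ∈ l, 1 ≤ p.1 ∧ p.2 ^ N = 1) ∧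
    (l.map Prod.fst).sum = w ∧ (∀ p ∈ l.head?, p ≠ (1, 1)) ∧
    Tendsto (coloredSum l) atTop (𝓝 x)}

end

/-!
The theorem rests on an identity of generating functions in a variable `x`. With
`c_j = 1 / (2 j + 1)`, the sums `t_n(1_k)` and `t⋆_n(1_k)` are the coefficients of
`T_n = ∏_{j < n} (1 + c_j x)` and `E_n = ∏_{j < n} 1 / (1 - c_j x)`. The first two expressions of the
theorem are thus the coefficients of
`F(x) = ∑ 4⁻ⁿ C(2n,n) c_n E_{n+1}(x)` and `(4/π) G(x)`, where `G(x) = ∑ c_n² T_n(x) E_{n+1}(x)`.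

*The identity `F = (4/π) G`.* At `x = -a` with `0 < a < 1/2`, integration by parts shows that
`c_n E_{n+1}(-a)` is proportional to `J_n = ∫₀^{π/2} sin^{2n} cos^{a+1}` (`binomVal_neg`), and that
`c_n T_n(-a) E_{n+1}(-a)` is proportional, with the same factor, to
`(-1)ⁿ B_n`, where `B_n = ∫₀^{π/2} cos^a θ cos((2n+1)θ) dθ` (`convVal_neg`). By the central binomial
series `∑ 4⁻ⁿ C(2n,n) J_n = ∫ cos^a` (`hasSum_sinMoment`), while the Fourier expansion
`π/4 = ∑ (-1)ⁿ cos((2n+1)θ) / (2n+1)` gives `∑ (-1)ⁿ B_n / (2n+1) = (π/4) ∫ cos^a`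
(`tendsto_sum_cosCoeff`). In place of Dixon's and Gauss's summation theorems, this compares the two
hypergeometric series directly. Negative `x` keeps all the integrands continuous.

*Coefficients.* All coefficients are nonnegative, and Raabe's test shows convergence at `x = 1/2`,
so both series may be rearranged and compared coefficientwise (`tsum_coeff_binomTerm`).

*Compositions.* Since `(1 + c x) / (1 - c x) = 1 + 2 ∑_{i ≥ 1} cⁱ xⁱ`, expanding `T_n E_n` produces
the sum over compositions with weight `2^{length}` (`coeff_tGen_mul_tStarGen_self`). The remaining
factor `c_n² / (1 - c_n x)` supplies the first exponent, which is at least two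
(`coeff_div_sq_eq_sum_admissible`).

*Colored values.* The indicator function `(1 - (-1)^i) / 2` of the odd numbers turns a multiple
`t`-harmonic sum into a rational combination of colored sums of level two (`tSum_mem_span`), each of
which converges because the leading exponent is at least two (`exists_tendsto_coloredSum`).
-/

/-! ### Recurrences for the harmonic sums -/

/-- The reciprocal `1 / (2 j + 1)` of the `j`-th odd number, counted from `j = 0`. -/
noncomputable def oddInv (j : ℕ) : ℝ := 1 / (2 * (j : ℝ) + 1)

lemma oddInv_pos (j : ℕ) : 0 < oddInv j := by
  unfold oddInv; positivity

lemma oddInv_le_one (j : ℕ) : oddInv j ≤ 1 := by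
  unfold oddInv
  rw [div_le_one (by positivity)]
  linarith [(Nat.cast_nonneg j : (0 : ℝ) ≤ j)]

lemma tSum_cons_zero (k : ℕ) (ks : List ℕ) : tSum (k :: ks) 0 = 0 := by
  simp [tSum]

lemma tSum_cons_succ (k : ℕ) (ks : List ℕ) (n : ℕ) :
    tSum (k :: ks) (n + 1) = tSum (k :: ks) n + oddInv n ^ k * tSum ks n := by
  simp only [tSum]
  rw [Finset.sum_Icc_succ_top (by omega)]
  have h : 2 * ((n + 1 : ℕ) : ℝ) - 1 = 2 * (n : ℝ) + 1 := by push_cast; ring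
  rw [h, Nat.add_sub_cancel, oddInv, one_div_pow]

lemma tStarSum_cons_zero (k : ℕ) (ks : List ℕ) : tStarSum (k :: ks) 0 = 0 := by
  simp [tStarSum]

lemma tStarSum_cons_succ (k : ℕ) (ks : List ℕ) (n : ℕ) :
    tStarSum (k :: ks) (n + 1) =
      tStarSum (k :: ks) n + oddInv n ^ k * tStarSum ks (n + 1) := by
  simp only [tStarSum]
  rw [Finset.sum_Icc_succ_top (by omega)]
  have h : 2 * ((n + 1 : ℕ) : ℝ) - 1 = 2 * (n : ℝ) + 1 := by push_cast; ring
  rw [h, oddInv, one_div_pow]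

lemma tSum_cons_eq_sum_range (k : ℕ) (ks : List ℕ) (n : ℕ) :
    tSum (k :: ks) n = ∑ j ∈ Finset.range n, oddInv j ^ k * tSum ks j := by
  induction n with
  | zero => simp [tSum_cons_zero]
  | succ n ih => rw [tSum_cons_succ, Finset.sum_range_succ, ih]

lemma tSum_nonneg (ks : List ℕ) : ∀ n, 0 ≤ tSum ks n := by
  induction ks with
  | nil => intro n; simp [tSum]
  | cons k ks ih =>
    intro n
    rw [tSum_cons_eq_sum_range]
    exact Finset.sum_nonneg fun j _ => mul_nonneg (pow_nonneg (oddInv_pos j).le _) (ih j)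

lemma tStarSum_ones_nonneg (m : ℕ) : ∀ n, 0 ≤ tStarSum (ones m) n := by
  induction m with
  | zero => intro n; simp [ones, tStarSum]
  | succ m ih =>
    intro n
    induction n with
    | zero => exact (tStarSum_cons_zero 1 (ones m)).ge
    | succ n ihn =>
      have h := tStarSum_cons_succ 1 (ones m) n
      have h1 := mul_nonneg (pow_nonneg (oddInv_pos n).le 1) (ih (n + 1))
      change 0 ≤ tStarSum (1 :: ones m) (n + 1)
      change 0 ≤ tStarSum (1 :: ones m) n at ihn
      linarith

/-! ### Generating functions -/

/-- The geometric power series `∑ₘ cᵐ Xᵐ = 1 / (1 - c X)`. -/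
noncomputable def geomSeries (c : ℝ) : PowerSeries ℝ := PowerSeries.mk fun m => c ^ m

/-- The generating function `∏_{j < n} (1 + X / (2 j + 1))` of `k ↦ t_n(1_k)`. -/
noncomputable def tGen (n : ℕ) : PowerSeries ℝ :=
  ∏ j ∈ Finset.range n, (1 + PowerSeries.C (oddInv j) * PowerSeries.X)

/-- The generating function `∏_{j < n} 1 / (1 - X / (2 j + 1))` of `k ↦ t⋆_n(1_k)`. -/
noncomputable def tStarGen (n : ℕ) : PowerSeries ℝ :=
  ∏ j ∈ Finset.range n, geomSeries (oddInv j)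

lemma geomSeries_mul (c : ℝ) : geomSeries c * (1 - PowerSeries.C c * PowerSeries.X) = 1 := by
  ext m
  cases m with
  | zero => simp [geomSeries, mul_sub, ← mul_assoc]
  | succ m =>
    rw [mul_sub, mul_one, ← mul_assoc, map_sub, PowerSeries.coeff_succ_mul_X,
      PowerSeries.coeff_mul_C, PowerSeries.coeff_one]
    simp [geomSeries, pow_succ]

lemma tGen_succ (n : ℕ) :
    tGen (n + 1) = tGen n * (1 + PowerSeries.C (oddInv n) * PowerSeries.X) :=
  Finset.prod_range_succ _ _

lemma tStarGen_succ (n : ℕ) : tStarGen (n + 1) = tStarGen n * geomSeries (oddInv n) :=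
  Finset.prod_range_succ _ _

lemma coeff_tGen (n : ℕ) : ∀ k, PowerSeries.coeff k (tGen n) = tSum (ones k) n := by
  induction n with
  | zero =>
    intro k
    cases k with
    | zero => simp [tGen, ones, tSum]
    | succ k => simp [tGen, ones, List.replicate_succ, tSum_cons_zero, PowerSeries.coeff_one]
  | succ n ih =>
    intro k
    rw [tGen_succ, mul_add, mul_one, mul_comm (PowerSeries.C _), ← mul_assoc, map_add,
      PowerSeries.coeff_mul_C]
    cases k with
    | zero => simp [ih 0, ones, tSum]
    | succ k =>
      rw [PowerSeries.coeff_succ_mul_X, ih, ih, ones, List.replicate_succ, tSum_cons_succ, ones,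
        pow_one, mul_comm]

lemma coeff_tStarGen (n : ℕ) :
    ∀ k, PowerSeries.coeff k (tStarGen n) = tStarSum (ones k) n := by
  induction n with
  | zero =>
    intro k
    cases k with
    | zero => simp [tStarGen, ones, tStarSum]
    | succ k =>
      simp [tStarGen, ones, List.replicate_succ, tStarSum_cons_zero, PowerSeries.coeff_one]
  | succ n ih =>
    have h : tStarGen (n + 1) * (1 - PowerSeries.C (oddInv n) * PowerSeries.X) = tStarGen n := by
      rw [tStarGen_succ, mul_assoc, geomSeries_mul, mul_one]
    intro k
    induction k with
    | zero =>
      have h0 := congrArg (PowerSeries.coeff 0) h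
      rw [mul_sub, mul_one, ← mul_assoc, map_sub, PowerSeries.coeff_zero_mul_X, sub_zero, ih] at h0
      simpa [ones, tStarSum] using h0
    | succ k ihk =>
      have h0 := congrArg (PowerSeries.coeff (k + 1)) h
      rw [mul_sub, mul_one, ← mul_assoc, map_sub, PowerSeries.coeff_succ_mul_X, ih,
        PowerSeries.coeff_mul_C, ihk] at h0
      have h1 : tStarSum (ones (k + 1)) (n + 1) =
          tStarSum (ones (k + 1)) n + oddInv n ^ 1 * tStarSum (ones k) (n + 1) :=
        tStarSum_cons_succ 1 (ones k) n
      rw [h1]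
      linarith

lemma coeff_tGen_mul_tStarGen (n m : ℕ) :
    PowerSeries.coeff m (tGen n * tStarGen (n + 1)) =
      ∑ k ∈ Finset.range (m + 1), tSum (ones k) n * tStarSum (ones (m - k)) (n + 1) := by
  rw [PowerSeries.coeff_mul, Finset.Nat.sum_antidiagonal_eq_sum_range_succ_mk]
  exact Finset.sum_congr rfl fun k _ => by rw [coeff_tGen, coeff_tStarGen]

/-! ### Sums over compositions -/

/-- The composition of `n + 1` with first block `p.1 + 1`, where `p.1 + p.2 = n`, followed by the
blocks of a composition of `p.2`. -/
def consComposition {n : ℕ} (p : ℕ × ℕ) (hp : p ∈ Finset.HasAntidiagonal.antidiagonal n)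
    (s : Composition p.2) : Composition (n + 1) where
  blocks := (p.1 + 1) :: s.blocks
  blocks_pos := by
    intro i hi
    rcases List.mem_cons.1 hi with rfl | hi
    · exact Nat.succ_pos _
    · exact s.blocks_pos hi
  blocks_sum := by
    have := Finset.HasAntidiagonal.mem_antidiagonal.1 hp
    rw [List.sum_cons, s.blocks_sum]
    omega

/-- A sum over the compositions of `n + 1`, organised by their first block. -/
lemma sum_composition_succ (n : ℕ) (f : List ℕ → ℝ) :
    ∑ s : Composition (n + 1), f s.blocks =
      ∑ p ∈ Finset.HasAntidiagonal.antidiagonal n,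
        ∑ s : Composition p.2, f ((p.1 + 1) :: s.blocks) := by
  rw [Finset.sum_sigma']
  symm
  refine Finset.sum_bij
    (fun x hx => consComposition x.1 (Finset.mem_sigma.1 hx).1 x.2) ?_ ?_ ?_ ?_
  · intro x hx; exact Finset.mem_univ _
  · rintro ⟨p, s⟩ hp ⟨q, t⟩ hq h
    have hb : (p.1 + 1) :: s.blocks = (q.1 + 1) :: t.blocks := congrArg Composition.blocks h
    have hp' := Finset.HasAntidiagonal.mem_antidiagonal.1 (Finset.mem_sigma.1 hp).1
    have hq' := Finset.HasAntidiagonal.mem_antidiagonal.1 (Finset.mem_sigma.1 hq).1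
    obtain ⟨h1, h2⟩ := List.cons.inj hb
    have hpq : p = q := by
      ext
      · omega
      · dsimp only at hp' hq'; omega
    subst hpq
    rw [Composition.ext h2]
  · intro s _
    obtain ⟨l, hpos, hsum⟩ := s
    cases l with
    | nil => simp at hsum
    | cons a l =>
      have ha : 0 < a := hpos (List.mem_cons_self)
      have hl : a + l.sum = n + 1 := by simpa using hsum
      refine ⟨⟨(a - 1, l.sum), ⟨l, fun h => hpos (List.mem_cons_of_mem _ h), rfl⟩⟩, ?_, ?_⟩
      · simp only [Finset.mem_sigma, Finset.HasAntidiagonal.mem_antidiagonal, Finset.mem_univ,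
          and_true]
        omega
      · apply Composition.ext
        change (a - 1 + 1) :: l = a :: l
        rw [Nat.sub_add_cancel ha]
  · intro x hx; rfl

/-- The weighted sum `∑_{|s| = m} 2^{len s} t_n(s)` over all compositions `s` of `m`. -/
noncomputable def weightedSum (n m : ℕ) : ℝ :=
  ∑ s : Composition m, (2 : ℝ) ^ s.blocks.length * tSum s.blocks n

lemma weightedSum_zero_right (n : ℕ) : weightedSum n 0 = 1 := by
  have h : ∀ s : Composition 0, s.blocks = [] := fun s => s.blocks_eq_nil.2 rfl
  simp [weightedSum, h, tSum, composition_card]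

lemma weightedSum_zero_succ (m : ℕ) : weightedSum 0 (m + 1) = 0 := by
  rw [weightedSum, sum_composition_succ m fun l => (2 : ℝ) ^ l.length * tSum l 0]
  simp [tSum_cons_zero]

/-- Splitting off the terms whose largest index is `n + 1`, according to the first exponent. -/
lemma weightedSum_succ (n m : ℕ) :
    weightedSum (n + 1) (m + 1) = weightedSum n (m + 1) +
      2 * ∑ p ∈ Finset.HasAntidiagonal.antidiagonal m, oddInv n ^ (p.1 + 1) * weightedSum n p.2 := by
  simp only [weightedSum]
  rw [sum_composition_succ m fun l => (2 : ℝ) ^ l.length * tSum l (n + 1),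
    sum_composition_succ m fun l => (2 : ℝ) ^ l.length * tSum l n, Finset.mul_sum,
    ← Finset.sum_add_distrib]
  refine Finset.sum_congr rfl fun p _ => ?_
  rw [Finset.mul_sum, Finset.mul_sum, ← Finset.sum_add_distrib]
  refine Finset.sum_congr rfl fun s _ => ?_
  rw [tSum_cons_succ, List.length_cons, pow_succ]
  ring

/-- Since `(1 + c X) / (1 - c X) = 1 + 2 ∑_{i ≥ 1} cⁱ Xⁱ`, expanding the product
`∏_{j < n} (1 + c_j X) / (1 - c_j X)` gives the weighted sum over compositions. -/
lemma coeff_tGen_mul_tStarGen_self (n : ℕ) :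
    ∀ m, PowerSeries.coeff m (tGen n * tStarGen n) = weightedSum n m := by
  induction n with
  | zero =>
    intro m
    cases m with
    | zero => simp [tGen, tStarGen, weightedSum_zero_right]
    | succ m => simp [tGen, tStarGen, weightedSum_zero_succ, PowerSeries.coeff_one]
  | succ n ih =>
    have key : tGen (n + 1) * tStarGen (n + 1) = tGen n * tStarGen n +
        PowerSeries.C (2 * oddInv n) * PowerSeries.X *
          (geomSeries (oddInv n) * (tGen n * tStarGen n)) := by
      rw [tGen_succ, tStarGen_succ, map_mul, map_ofNat]
      linear_combination (tGen n * tStarGen n) * geomSeries_mul (oddInv n)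
    intro m
    rw [key, map_add, ih, mul_comm (PowerSeries.C _), mul_assoc]
    cases m with
    | zero => simp [weightedSum_zero_right]
    | succ m =>
      rw [mul_comm PowerSeries.X, PowerSeries.coeff_succ_mul_X, PowerSeries.coeff_C_mul,
        PowerSeries.coeff_mul, weightedSum_succ, mul_assoc, Finset.mul_sum]
      congr 2
      refine Finset.sum_congr rfl fun p _ => ?_
      rw [ih, geomSeries, PowerSeries.coeff_mk, pow_succ]
      ring

/-- A sum over the admissible compositions of `m + 2`, organised by their first block. -/
lemma sum_admissible (m : ℕ) (f : List ℕ → ℝ) :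
    ∑ s : Composition (m + 2) with AdmissibleIndex s.blocks, f s.blocks =
      ∑ p ∈ Finset.HasAntidiagonal.antidiagonal m,
        ∑ s : Composition p.2, f ((p.1 + 2) :: s.blocks) := by
  classical
  rw [Finset.sum_filter]
  have h := sum_composition_succ (m + 1) fun l => if AdmissibleIndex l then f l else 0
  rw [Finset.Nat.sum_antidiagonal_succ] at h
  simp only [AdmissibleIndex, List.head?_cons, Option.mem_some_iff, forall_eq'] at h
  have h2 : ∀ x : ℕ, 2 ≤ x + 1 + 1 := fun x => by omega
  have h3 : ¬ 2 ≤ 0 + 1 := by omega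
  simp only [h2, h3, if_true, if_false, Finset.sum_const_zero, zero_add] at h
  simpa [AdmissibleIndex] using h

/-- The `n`-th summand of the middle expression is the contribution of the indices with `n₁ = n + 1`
to the weighted sum of multiple `t`-values. -/
lemma coeff_div_sq_eq_sum_admissible (n m : ℕ) :
    PowerSeries.coeff m (tGen n * tStarGen (n + 1)) * oddInv n ^ 2 =
      ∑ s : Composition (m + 2) with AdmissibleIndex s.blocks,
        (2 : ℝ) ^ (s.blocks.length - 1) *
          (oddInv n ^ s.blocks.headI * tSum s.blocks.tail n) := by
  rw [sum_admissible m fun l =>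
    (2 : ℝ) ^ (l.length - 1) * (oddInv n ^ l.headI * tSum l.tail n), tStarGen_succ, ← mul_assoc,
    mul_comm _ (geomSeries _), PowerSeries.coeff_mul, Finset.sum_mul]
  refine Finset.sum_congr rfl fun p _ => ?_
  rw [coeff_tGen_mul_tStarGen_self, geomSeries, PowerSeries.coeff_mk, weightedSum, Finset.mul_sum,
    Finset.sum_mul]
  refine Finset.sum_congr rfl fun s _ => ?_
  simp only [List.length_cons, List.headI_cons, List.tail_cons, Nat.add_sub_cancel]
  ring

/-! ### Trigonometric integrals -/

/-- The moment `∫₀^{π/2} sin^{2n} θ cos^{a+1} θ dθ`. -/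
noncomputable def sinMoment (a : ℝ) (n : ℕ) : ℝ :=
  ∫ θ in (0 : ℝ)..(Real.pi / 2), Real.sin θ ^ (2 * n) * Real.cos θ ^ (a + 1)

/-- The Fourier coefficient `∫₀^{π/2} cos^a θ cos((2n+1)θ) dθ`. -/
noncomputable def cosCoeff (a : ℝ) (n : ℕ) : ℝ :=
  ∫ θ in (0 : ℝ)..(Real.pi / 2), Real.cos θ ^ a * Real.cos ((2 * n + 1) * θ)

/-- The integral `∫₀^{π/2} cos^a θ dθ`. -/
noncomputable def cosIntegral (a : ℝ) : ℝ := ∫ θ in (0 : ℝ)..(Real.pi / 2), Real.cos θ ^ a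

lemma continuous_cos_rpow {a : ℝ} (ha : 0 ≤ a) : Continuous fun θ : ℝ => Real.cos θ ^ a :=
  Real.continuous_cos.rpow_const fun _ => Or.inr ha

lemma uIcc_zero_pi_div_two : Set.uIcc 0 (Real.pi / 2) = Set.Icc 0 (Real.pi / 2) :=
  Set.uIcc_of_le (by positivity)

lemma cos_nonneg_of_mem_Icc {θ : ℝ} (h : θ ∈ Set.Icc 0 (Real.pi / 2)) : 0 ≤ Real.cos θ :=
  Real.cos_nonneg_of_mem_Icc ⟨by linarith [h.1, Real.pi_pos], h.2⟩

lemma hasDerivAt_cos_rpow {b : ℝ} (hb : 1 ≤ b) (θ : ℝ) :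
    HasDerivAt (fun θ : ℝ => Real.cos θ ^ b) (-Real.sin θ * b * Real.cos θ ^ (b - 1)) θ :=
  (Real.hasDerivAt_cos θ).rpow_const (Or.inr hb)

lemma sinMoment_zero_pos {a : ℝ} (ha : 0 < a) : 0 < sinMoment a 0 := by
  unfold sinMoment
  refine intervalIntegral.intervalIntegral_pos_of_pos_on ?_ ?_ (by positivity)
  · exact (by
      simpa using (continuous_cos_rpow (by linarith : (0 : ℝ) ≤ a + 1))
        : Continuous _).intervalIntegrable _ _
  · intro θ hθ
    have : 0 < Real.cos θ := Real.cos_pos_of_mem_Ioo ⟨by linarith [hθ.1, Real.pi_pos], hθ.2⟩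
    simpa using Real.rpow_pos_of_pos this _

lemma continuous_sin_pow_mul_cos_rpow {a : ℝ} (ha : 0 < a) (n : ℕ) :
    Continuous fun θ : ℝ => Real.sin θ ^ (2 * n) * Real.cos θ ^ (a + 1) :=
  (Real.continuous_sin.pow _).mul (continuous_cos_rpow (by linarith))

/-- Integration of the derivative of `sin^{2n+1} θ cos^{a+2} θ`. -/
lemma sinMoment_succ {a : ℝ} (ha : 0 < a) (n : ℕ) :
    (2 * (n : ℝ) + 3 + a) * sinMoment a (n + 1) = (2 * (n : ℝ) + 1) * sinMoment a n := by
  have hc := fun n => (continuous_sin_pow_mul_cos_rpow ha n).intervalIntegrable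
    (μ := MeasureTheory.volume) 0 (Real.pi / 2)
  have h := intervalIntegral.integral_eq_sub_of_hasDerivAt (a := 0) (b := Real.pi / 2)
    (f := fun θ => Real.sin θ ^ (2 * n + 1) * Real.cos θ ^ (a + 2))
    (f' := fun θ => (2 * (n : ℝ) + 1) * (Real.sin θ ^ (2 * n) * Real.cos θ ^ (a + 1)) -
      (2 * (n : ℝ) + 3 + a) * (Real.sin θ ^ (2 * (n + 1)) * Real.cos θ ^ (a + 1))) ?_
      (((hc n).const_mul _).sub ((hc (n + 1)).const_mul _))
  · rw [intervalIntegral.integral_sub ((hc n).const_mul _) ((hc (n + 1)).const_mul _),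
      intervalIntegral.integral_const_mul, intervalIntegral.integral_const_mul] at h
    simp only [Real.cos_pi_div_two, Real.sin_zero, Real.zero_rpow (by linarith : a + 2 ≠ 0)] at h
    simp only [ne_eq, Nat.add_eq_zero_iff, one_ne_zero, and_false, not_false_eq_true, zero_pow,
      zero_mul, mul_zero, sub_zero] at h
    unfold sinMoment
    linarith
  · intro θ hθ
    rw [uIcc_zero_pi_div_two] at hθ
    have h1 := ((Real.hasDerivAt_sin θ).pow (2 * n + 1)).mul
      (hasDerivAt_cos_rpow (by linarith : 1 ≤ a + 2) θ)
    refine h1.congr_deriv ?_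
    have e1 : Real.cos θ ^ (a + 2) = Real.cos θ ^ (a + 1) * Real.cos θ := by
      rw [show a + 2 = (a + 1) + 1 by ring,
        Real.rpow_add_one' (cos_nonneg_of_mem_Icc hθ) (by linarith)]
    rw [e1, show a + 2 - 1 = a + 1 by ring]
    have e2 : Real.cos θ ^ 2 = 1 - Real.sin θ ^ 2 := by linarith [Real.sin_sq_add_cos_sq θ]
    simp only [Nat.add_sub_cancel, Nat.cast_add, Nat.cast_mul, Nat.cast_ofNat, Nat.cast_one,
      Pi.pow_apply]
    linear_combination (2 * (n : ℝ) + 1) * Real.sin θ ^ (2 * n) * Real.cos θ ^ (a + 1) * e2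

lemma continuous_cos_rpow_mul_cos {a : ℝ} (ha : 0 < a) (b : ℝ) :
    Continuous fun θ : ℝ => Real.cos θ ^ a * Real.cos (b * θ) :=
  (continuous_cos_rpow ha.le).mul (by fun_prop)

/-- Integration of the derivative of `cos^{a+1} θ sin((2n+2)θ)`. -/
lemma cosCoeff_succ {a : ℝ} (ha : 0 < a) (n : ℕ) :
    (2 * (n : ℝ) + 3 + a) * cosCoeff a (n + 1) = -((2 * (n : ℝ) + 1 - a) * cosCoeff a n) := by
  have hc := fun n : ℕ => (continuous_cos_rpow_mul_cos ha (2 * n + 1)).intervalIntegrable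
    (μ := MeasureTheory.volume) 0 (Real.pi / 2)
  have h := intervalIntegral.integral_eq_sub_of_hasDerivAt (a := 0) (b := Real.pi / 2)
    (f := fun θ => 2 * (Real.cos θ ^ (a + 1) * Real.sin ((2 * n + 2) * θ)))
    (f' := fun θ => (2 * (n : ℝ) + 1 - a) * (Real.cos θ ^ a * Real.cos ((2 * n + 1) * θ)) +
      (2 * (n : ℝ) + 3 + a) * (Real.cos θ ^ a * Real.cos ((2 * (n + 1 : ℕ) + 1) * θ))) ?_
      (((hc n).const_mul _).add ((hc (n + 1)).const_mul _))
  · rw [intervalIntegral.integral_add ((hc n).const_mul _) ((hc (n + 1)).const_mul _),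
      intervalIntegral.integral_const_mul, intervalIntegral.integral_const_mul] at h
    simp only [Real.cos_pi_div_two, Real.sin_zero, Real.zero_rpow (by linarith : a + 1 ≠ 0),
      zero_mul, mul_zero, sub_zero] at h
    unfold cosCoeff
    linarith
  · intro θ hθ
    rw [uIcc_zero_pi_div_two] at hθ
    have h1 := ((hasDerivAt_cos_rpow (by linarith : 1 ≤ a + 1) θ).mul
      (((hasDerivAt_id θ).const_mul (2 * (n : ℝ) + 2)).sin)).const_mul 2
    refine h1.congr_deriv ?_
    rw [Real.rpow_add_one' (cos_nonneg_of_mem_Icc hθ) (by linarith), add_sub_cancel_right]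
    have e1 : Real.cos ((2 * n + 1) * θ) = Real.cos ((2 * n + 2) * θ) * Real.cos θ +
        Real.sin ((2 * n + 2) * θ) * Real.sin θ := by
      rw [← Real.cos_sub]; congr 1; ring
    have e2 : Real.cos ((2 * (n + 1 : ℕ) + 1) * θ) = Real.cos ((2 * n + 2) * θ) * Real.cos θ -
        Real.sin ((2 * n + 2) * θ) * Real.sin θ := by
      rw [← Real.cos_add]; congr 1; push_cast; ring
    rw [e1, e2]
    simp only [id]
    ring

lemma cosCoeff_zero {a : ℝ} (ha : 0 < a) : cosCoeff a 0 = sinMoment a 0 := by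
  unfold cosCoeff sinMoment
  refine intervalIntegral.integral_congr fun θ hθ => ?_
  rw [uIcc_zero_pi_div_two] at hθ
  simp [Real.rpow_add_one' (cos_nonneg_of_mem_Icc hθ) (by linarith : a + 1 ≠ 0)]

/-! ### Summing the moments with the central binomial series -/

lemma ringChoose_eq_centralBinom (n : ℕ) :
    Ring.choose ((1 / 2 : ℝ) + n - 1) n = 1 / (4 : ℝ) ^ n * ((2 * n).choose n : ℝ) := by
  rw [← Ring.multichoose_eq, ← Nat.centralBinom_eq_two_mul_choose]
  have h1 := Ring.factorial_nsmul_multichoose_eq_ascPochhammer (1 / 2 : ℝ) n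
  have h2 : ∀ n : ℕ, (ascPochhammer ℕ n).smeval (1 / 2 : ℝ) =
      (n.factorial : ℝ) * (1 / (4 : ℝ) ^ n * (n.centralBinom : ℝ)) := by
    intro n
    induction n with
    | zero => simp
    | succ n ih =>
      have h3 : ((n : ℝ) + 1) * ((n + 1).centralBinom : ℝ) =
          2 * (2 * n + 1) * (n.centralBinom : ℝ) := by
        exact_mod_cast Nat.succ_mul_centralBinom_succ n
      rw [ascPochhammer_succ_right, Polynomial.smeval_mul, ih, Nat.factorial_succ]
      simp only [Polynomial.smeval_add, Polynomial.smeval_X, Polynomial.smeval_natCast]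
      push_cast
      rw [pow_succ, nsmul_eq_mul]
      field_simp
      linear_combination (-2 : ℝ) * 4 ^ n * h3
  rw [h2, nsmul_eq_mul] at h1
  exact mul_left_cancel₀ (by exact_mod_cast n.factorial_ne_zero) h1

/-- The central binomial series `∑ C(2n,n) 4⁻ⁿ sin^{2n} θ = 1 / cos θ`. -/
lemma hasSum_centralBinom_sin {θ : ℝ} (hθ : 0 < Real.cos θ) :
    HasSum (fun n : ℕ => 1 / (4 : ℝ) ^ n * ((2 * n).choose n : ℝ) * Real.sin θ ^ (2 * n))
      (1 / Real.cos θ) := by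
  have hs : Real.sin θ ^ 2 < 1 := by nlinarith [Real.sin_sq_add_cos_sq θ]
  have h := (Real.one_div_one_sub_rpow_hasFPowerSeriesOnBall_zero (1 / 2)).hasSum
    (y := Real.sin θ ^ 2) (by
      rw [← ENNReal.ofReal_one, Metric.eball_ofReal]
      simpa [abs_of_nonneg (sq_nonneg (Real.sin θ))] using hs)
  have e : (1 - (0 + Real.sin θ ^ 2)) ^ (1 / 2 : ℝ) = Real.cos θ := by
    rw [← Real.sqrt_eq_rpow, zero_add, ← Real.cos_sq', Real.sqrt_sq hθ.le]
  rw [e] at h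
  convert! h using 2 with n
  rw [FormalMultilinearSeries.ofScalars_apply_eq, ringChoose_eq_centralBinom, pow_mul,
    smul_eq_mul]

lemma hasSum_centralBinom_sin_mul_cos {a θ : ℝ} (ha : 0 < a) (hθ : 0 ≤ Real.cos θ) :
    HasSum (fun n : ℕ => 1 / (4 : ℝ) ^ n * ((2 * n).choose n : ℝ) *
      (Real.sin θ ^ (2 * n) * Real.cos θ ^ (a + 1))) (Real.cos θ ^ a) := by
  -- At `θ = π / 2` every summand vanishes, and so does `cos^a θ` because `a > 0`.
  rcases hθ.eq_or_lt with h | h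
  · rw [← h, Real.zero_rpow (by linarith), Real.zero_rpow (by linarith)]
    simp
  · have h1 := (hasSum_centralBinom_sin h).mul_right (Real.cos θ ^ (a + 1))
    convert! h1 using 1
    · funext n; ring
    · rw [Real.rpow_add_one h.ne']; field_simp

lemma hasSum_sinMoment {a : ℝ} (ha : 0 < a) :
    HasSum (fun n : ℕ => 1 / (4 : ℝ) ^ n * ((2 * n).choose n : ℝ) * sinMoment a n)
      (cosIntegral a) := by
  set F : ℕ → ℝ → ℝ := fun n θ => 1 / (4 : ℝ) ^ n * ((2 * n).choose n : ℝ) *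
      (Real.sin θ ^ (2 * n) * Real.cos θ ^ (a + 1)) with hF
  have hpi : (0 : ℝ) ≤ Real.pi / 2 := by positivity
  have hFc : ∀ n, Continuous (F n) := fun n =>
    continuous_const.mul (continuous_sin_pow_mul_cos_rpow ha n)
  have hF0 : ∀ n, ∀ θ ∈ Set.Icc 0 (Real.pi / 2), 0 ≤ F n θ := fun n θ hθ => by
    have h1 := Real.rpow_nonneg (cos_nonneg_of_mem_Icc hθ) (a + 1)
    have h2 : 0 ≤ Real.sin θ ^ (2 * n) := by rw [pow_mul]; positivity
    exact mul_nonneg (by positivity) (mul_nonneg h2 h1)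
  have hI : ∀ n, ∫ θ in (0 : ℝ)..(Real.pi / 2), F n θ =
      1 / (4 : ℝ) ^ n * ((2 * n).choose n : ℝ) * sinMoment a n := fun n => by
    rw [hF, sinMoment, intervalIntegral.integral_const_mul]
  have hsum : Summable fun n => ∫ θ in (0 : ℝ)..(Real.pi / 2), F n θ := by
    refine summable_of_sum_range_le (c := cosIntegral a)
      (fun n => intervalIntegral.integral_nonneg hpi (hF0 n)) fun N => ?_
    rw [← intervalIntegral.integral_finsetSum fun n _ => (hFc n).intervalIntegrable _ _]
    refine intervalIntegral.integral_mono_on hpi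
      ((continuous_finsetSum _ fun n _ => hFc n).intervalIntegrable _ _)
      ((continuous_cos_rpow ha.le).intervalIntegrable _ _) fun θ hθ => ?_
    exact sum_le_hasSum _ (fun n _ => hF0 n θ hθ)
      (hasSum_centralBinom_sin_mul_cos ha (cos_nonneg_of_mem_Icc hθ))
  have hmem : ∀ θ ∈ Set.Ioc 0 (Real.pi / 2), θ ∈ Set.Icc 0 (Real.pi / 2) :=
    fun θ h => Set.Ioc_subset_Icc_self h
  have h := MeasureTheory.hasSum_integral_of_summable_integral_norm
    (μ := MeasureTheory.volume.restrict (Set.Ioc 0 (Real.pi / 2))) (F := F)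
    (fun n => ((hFc n).intervalIntegrable 0 (Real.pi / 2)).1) (by
      convert hsum using 2 with n
      rw [intervalIntegral.integral_of_le hpi]
      refine MeasureTheory.setIntegral_congr_fun measurableSet_Ioc fun θ hθ => ?_
      exact Real.norm_of_nonneg (hF0 n θ (hmem θ hθ)))
  convert! h using 1
  · funext n
    rw [← hI, intervalIntegral.integral_of_le hpi]
  · rw [cosIntegral, intervalIntegral.integral_of_le hpi]
    refine MeasureTheory.setIntegral_congr_fun measurableSet_Ioc fun θ hθ => ?_
    exact (hasSum_centralBinom_sin_mul_cos ha
      (cos_nonneg_of_mem_Icc (hmem θ hθ))).tsum_eq.symm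

/-! ### Summing the Fourier coefficients -/

/-- The partial Fourier sum `∑_{n < N} (-1)ⁿ cos((2n+1)θ) / (2n+1)` of the constant `π / 4`. -/
noncomputable def leibnizKernel (N : ℕ) (θ : ℝ) : ℝ :=
  ∑ n ∈ Finset.range N, (-1 : ℝ) ^ n * (Real.cos ((2 * n + 1) * θ) / (2 * n + 1))

/-- The tail `∫_θ^{π/2} cos^a`. -/
noncomputable def cosTail (a θ : ℝ) : ℝ := ∫ x in θ..(Real.pi / 2), Real.cos x ^ a

lemma two_cos_mul_sum_sin (N : ℕ) (θ : ℝ) :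
    2 * Real.cos θ * ∑ n ∈ Finset.range N, (-1 : ℝ) ^ n * Real.sin ((2 * n + 1) * θ) =
      -((-1 : ℝ) ^ N * Real.sin (2 * N * θ)) := by
  induction N with
  | zero => simp
  | succ N ih =>
    have e1 : Real.sin (2 * (N + 1 : ℕ) * θ) = Real.sin ((2 * N + 1) * θ) * Real.cos θ +
        Real.cos ((2 * N + 1) * θ) * Real.sin θ := by
      rw [← Real.sin_add]; congr 1; push_cast; ring
    have e2 : Real.sin (2 * N * θ) = Real.sin ((2 * N + 1) * θ) * Real.cos θ -
        Real.cos ((2 * N + 1) * θ) * Real.sin θ := by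
      rw [← Real.sin_sub]; congr 1; ring
    rw [Finset.sum_range_succ, mul_add, ih, e1, e2, pow_succ]
    ring

lemma hasDerivAt_leibnizKernel (N : ℕ) (θ : ℝ) :
    HasDerivAt (leibnizKernel N)
      (-∑ n ∈ Finset.range N, (-1 : ℝ) ^ n * Real.sin ((2 * n + 1) * θ)) θ := by
  have h : HasDerivAt (leibnizKernel N) (∑ n ∈ Finset.range N,
      (-1 : ℝ) ^ n * ((-Real.sin ((2 * n + 1) * θ) * ((2 * n + 1) * 1)) / (2 * n + 1))) θ := by
    unfold leibnizKernel
    refine HasDerivAt.fun_sum fun n _ => ?_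
    exact ((((hasDerivAt_id θ).const_mul (2 * (n : ℝ) + 1)).cos).div_const _).const_mul _
  refine h.congr_deriv ?_
  rw [← Finset.sum_neg_distrib]
  refine Finset.sum_congr rfl fun n _ => ?_
  have : (2 * (n : ℝ) + 1) ≠ 0 := by positivity
  field_simp

lemma hasDerivAt_cosTail {a : ℝ} (ha : 0 < a) (θ : ℝ) :
    HasDerivAt (cosTail a) (-Real.cos θ ^ a) θ :=
  intervalIntegral.integral_hasDerivAt_left
    ((continuous_cos_rpow ha.le).intervalIntegrable _ _)
    ((continuous_cos_rpow ha.le).stronglyMeasurableAtFilter _ _)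
    (continuous_cos_rpow ha.le).continuousAt

/-- By Jordan's inequality, `∫_θ^{π/2} cos^a` is at most a multiple of `cos θ`. -/
lemma abs_cosTail_div_cos_le {a θ : ℝ} (ha : 0 < a) (hθ : θ ∈ Set.Icc 0 (Real.pi / 2)) :
    |cosTail a θ / (2 * Real.cos θ)| ≤ Real.pi / 4 := by
  have hc := cos_nonneg_of_mem_Icc hθ
  have h1 : ‖cosTail a θ‖ ≤ 1 * |Real.pi / 2 - θ| := by
    rw [cosTail]
    refine intervalIntegral.norm_integral_le_of_norm_le_const fun x hx => ?_
    rw [Set.uIoc_of_le hθ.2] at hx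
    have hx' := cos_nonneg_of_mem_Icc ⟨hθ.1.trans hx.1.le, hx.2⟩
    rw [Real.norm_of_nonneg (Real.rpow_nonneg hx' _)]
    exact Real.rpow_le_one hx' (Real.cos_le_one x) ha.le
  rw [one_mul, abs_of_nonneg (sub_nonneg.2 hθ.2), Real.norm_eq_abs] at h1
  have h2 := Real.one_sub_mul_le_cos hθ.1 hθ.2
  have h3 : Real.pi / 2 - θ ≤ Real.pi / 2 * Real.cos θ := by
    have := mul_le_mul_of_nonneg_left h2 (by positivity : 0 ≤ Real.pi / 2)
    have e : Real.pi / 2 * (1 - 2 / Real.pi * θ) = Real.pi / 2 - θ := by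
      field_simp
    linarith
  rw [abs_div, abs_of_nonneg (by positivity : 0 ≤ 2 * Real.cos θ)]
  refine div_le_of_le_mul₀ (by positivity) (by positivity) ?_
  linarith

/-- The Riemann–Lebesgue lemma for the sine integrals of an integrable function. -/
lemma tendsto_integral_sin_mul {g : ℝ → ℝ} (hg : MeasureTheory.Integrable g) :
    Tendsto (fun N : ℕ => ∫ θ, Real.sin (2 * N * θ) * g θ) atTop (𝓝 0) := by
  have h := Real.tendsto_integral_exp_smul_cocompact fun θ => (g θ : ℂ)
  -- The character is `v ↦ exp(-2πi v w)`, so frequency `2 N` is `w = N / π`.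
  have hw : Tendsto (fun N : ℕ => (N : ℝ) / Real.pi) atTop (cocompact ℝ) :=
    (tendsto_natCast_atTop_atTop.atTop_div_const Real.pi_pos).mono_right atTop_le_cocompact
  have h2 := (Complex.continuous_im.tendsto 0).comp (h.comp hw)
  have h3 := h2.neg
  rw [Complex.zero_im, neg_zero] at h3
  refine h3.congr fun N => ?_
  have hint : MeasureTheory.Integrable fun θ : ℝ =>
      Real.fourierChar (-(θ * ((N : ℝ) / Real.pi))) • (g θ : ℂ) :=
    by simpa [mul_comm] using (Real.fourierIntegral_convergent_iff (f := fun θ => (g θ : ℂ))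
      ((N : ℝ) / Real.pi)).2 hg.ofReal
  simp only [Function.comp_apply]
  have h4 := integral_im hint
  rw [RCLike.im_eq_complex_im] at h4
  rw [← h4, ← MeasureTheory.integral_neg]
  refine MeasureTheory.integral_congr_ae (Eventually.of_forall fun θ => ?_)
  have e : ((2 * Real.pi * -(θ * ((N : ℝ) / Real.pi)) : ℝ) : ℂ) * Complex.I =
      ((-(2 * N * θ) : ℝ) : ℂ) * Complex.I := by
    congr 2
    field_simp
  simp only [Circle.smul_def, Real.fourierChar_apply, smul_eq_mul]
  rw [e]
  change -(Complex.exp (((-(2 * N * θ) : ℝ) : ℂ) * Complex.I) * (g θ : ℂ)).im = _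
  rw [Complex.im_mul_ofReal, Complex.exp_ofReal_mul_I_im, Real.sin_neg]
  ring

/-- Integration by parts turns the partial sums into Leibniz's partial sums for `π / 4`, up to a
sine integral that vanishes in the limit. -/
lemma integral_cos_mul_leibnizKernel {a : ℝ} (ha : 0 < a) (N : ℕ) :
    ∫ θ in (0 : ℝ)..(Real.pi / 2), leibnizKernel N θ * Real.cos θ ^ a =
      leibnizKernel N 0 * cosIntegral a + (-1 : ℝ) ^ N *
        ∫ θ in (0 : ℝ)..(Real.pi / 2),
          Real.sin (2 * N * θ) * (cosTail a θ / (2 * Real.cos θ)) := by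
  have hu' : Continuous fun θ : ℝ =>
      -∑ n ∈ Finset.range N, (-1 : ℝ) ^ n * Real.sin ((2 * n + 1) * θ) := by fun_prop
  have h := intervalIntegral.integral_mul_deriv_eq_deriv_mul (a := 0) (b := Real.pi / 2)
    (fun θ _ => hasDerivAt_leibnizKernel N θ) (fun θ _ => (hasDerivAt_cosTail ha θ).neg)
    (hu'.intervalIntegrable _ _)
    (((continuous_cos_rpow ha.le).neg.neg).intervalIntegrable _ _)
  simp only [neg_neg, Pi.neg_apply] at h
  have h0 : cosTail a (Real.pi / 2) = 0 := intervalIntegral.integral_same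
  rw [h, h0, ← intervalIntegral.integral_const_mul, cosIntegral, ← cosTail, neg_zero, mul_zero,
    zero_sub, mul_neg, neg_neg, sub_eq_add_neg, ← intervalIntegral.integral_neg]
  congr 1
  refine intervalIntegral.integral_congr fun θ _ => ?_
  -- At the end point the quotient has the junk value `0`, and the other side vanishes as well.
  by_cases hc : θ = Real.pi / 2
  · simp [hc, h0]
  · have hθ : θ ∈ Set.Icc 0 (Real.pi / 2) := by rwa [← uIcc_zero_pi_div_two]
    have hpos : 0 < Real.cos θ := Real.cos_pos_of_mem_Ioo
      ⟨by linarith [hθ.1, Real.pi_pos], lt_of_le_of_ne hθ.2 hc⟩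
    have h1 := two_cos_mul_sum_sin N θ
    generalize Real.sin (2 * N * θ) = S at h1 ⊢
    field_simp
    linear_combination (-cosTail a θ) * h1

/-- The series `∑ (-1)ⁿ (∫ cos^a cos((2n+1)·)) / (2n+1)`, summed against the Fourier expansion
`π / 4 = ∑ (-1)ⁿ cos((2n+1)θ) / (2n+1)`. -/
lemma tendsto_sum_cosCoeff {a : ℝ} (ha : 0 < a) :
    Tendsto (fun N => ∑ n ∈ Finset.range N, (-1 : ℝ) ^ n * cosCoeff a n / (2 * n + 1)) atTop
      (𝓝 (Real.pi / 4 * cosIntegral a)) := by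
  have hpi : (0 : ℝ) ≤ Real.pi / 2 := by positivity
  set g : ℝ → ℝ := (Set.Ioc 0 (Real.pi / 2)).indicator
    fun θ => cosTail a θ / (2 * Real.cos θ) with hg
  have hVc : Continuous (cosTail a) :=
    continuous_iff_continuousAt.2 fun θ => (hasDerivAt_cosTail ha θ).continuousAt
  have hgint : MeasureTheory.Integrable g := by
    refine (MeasureTheory.integrable_indicator_iff measurableSet_Ioc).2 ?_
    refine MeasureTheory.Measure.integrableOn_of_bounded (M := Real.pi / 4) (by simp) ?_ ?_
    · exact (hVc.measurable.div
        (Real.continuous_cos.measurable.const_mul 2)).aestronglyMeasurable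
    · refine (MeasureTheory.ae_restrict_iff' measurableSet_Ioc).2 (Eventually.of_forall ?_)
      exact fun θ hθ => abs_cosTail_div_cos_le ha (Set.Ioc_subset_Icc_self hθ)
  have hRL := tendsto_integral_sin_mul hgint
  have hRL' : Tendsto (fun N : ℕ => (-1 : ℝ) ^ N * ∫ θ in (0 : ℝ)..(Real.pi / 2),
      Real.sin (2 * N * θ) * (cosTail a θ / (2 * Real.cos θ))) atTop (𝓝 0) := by
    rw [tendsto_zero_iff_norm_tendsto_zero] at hRL ⊢
    refine hRL.congr fun N => ?_
    rw [norm_mul, norm_pow, norm_neg, norm_one, one_pow, one_mul,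
      intervalIntegral.integral_of_le hpi, ← MeasureTheory.integral_indicator measurableSet_Ioc]
    congr 2
    funext θ
    rw [hg, ← Set.indicator_mul_right _ (fun θ => Real.sin (2 * N * θ))]
  have hL : Tendsto (fun N => leibnizKernel N 0) atTop (𝓝 (Real.pi / 4)) := by
    refine Real.tendsto_sum_pi_div_four.congr fun N => ?_
    simp [leibnizKernel, div_eq_mul_inv]
  have h := (hL.mul_const (cosIntegral a)).add hRL'
  rw [add_zero] at h
  refine h.congr fun N => ?_
  rw [← integral_cos_mul_leibnizKernel ha]
  have hc : ∀ n : ℕ, Continuous fun θ : ℝ =>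
      (-1 : ℝ) ^ n / (2 * n + 1) * (Real.cos θ ^ a * Real.cos ((2 * n + 1) * θ)) :=
    fun n => continuous_const.mul (continuous_cos_rpow_mul_cos ha _)
  have e : ∀ θ : ℝ, leibnizKernel N θ * Real.cos θ ^ a = ∑ n ∈ Finset.range N,
      (-1 : ℝ) ^ n / (2 * n + 1) * (Real.cos θ ^ a * Real.cos ((2 * n + 1) * θ)) := fun θ => by
    rw [leibnizKernel, Finset.sum_mul]
    exact Finset.sum_congr rfl fun n _ => by ring
  simp only [e]
  rw [intervalIntegral.integral_finsetSum fun n _ => (hc n).intervalIntegrable _ _]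
  refine Finset.sum_congr rfl fun n _ => ?_
  rw [intervalIntegral.integral_const_mul, cosCoeff]
  ring

/-! ### Evaluating the generating functions -/

/-- The power series `f` converges at `x` to the value `v`. -/
def EvalsTo (f : PowerSeries ℝ) (x v : ℝ) : Prop :=
  HasSum (fun m => PowerSeries.coeff m f * x ^ m) v

lemma EvalsTo.mul {f g : PowerSeries ℝ} {x v w : ℝ} (hf : EvalsTo f x v) (hg : EvalsTo g x w) :
    EvalsTo (f * g) x (v * w) := by
  have hf' := Summable.norm (HasSum.summable hf)
  have hg' := Summable.norm (HasSum.summable hg)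
  have h1 := tsum_mul_tsum_eq_tsum_sum_antidiagonal_of_summable_norm hf' hg'
  have h2 := (summable_norm_sum_mul_antidiagonal_of_summable_norm hf' hg').of_norm
  rw [HasSum.tsum_eq hf, HasSum.tsum_eq hg] at h1
  have h3 := h2.hasSum
  rw [← h1] at h3
  unfold EvalsTo
  convert! h3 using 2 with m
  rw [PowerSeries.coeff_mul, Finset.sum_mul]
  refine Finset.sum_congr rfl fun p hp => ?_
  rw [← Finset.HasAntidiagonal.mem_antidiagonal.1 hp, pow_add]
  ring

lemma evalsTo_one (x : ℝ) : EvalsTo 1 x 1 := by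
  unfold EvalsTo
  convert! hasSum_ite_eq (0 : ℕ) (1 : ℝ) using 2 with m
  rw [PowerSeries.coeff_one]
  split_ifs with h <;> simp [h]

lemma evalsTo_linear (c x : ℝ) :
    EvalsTo (1 + PowerSeries.C c * PowerSeries.X) x (1 + c * x) := by
  have h : HasSum (fun m : ℕ => PowerSeries.coeff m (PowerSeries.C c * PowerSeries.X) * x ^ m)
      (c * x) := by
    convert! hasSum_ite_eq (1 : ℕ) (c * x) using 2 with m
    rw [PowerSeries.coeff_C_mul, PowerSeries.coeff_X]
    split_ifs with h <;> simp [h]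
  unfold EvalsTo
  convert! HasSum.add (evalsTo_one x) h using 2 with m
  rw [map_add, add_mul]

lemma evalsTo_geomSeries {c x : ℝ} (h : |c * x| < 1) :
    EvalsTo (geomSeries c) x (1 - c * x)⁻¹ := by
  unfold EvalsTo
  convert! hasSum_geometric_of_abs_lt_one h using 2 with m
  rw [geomSeries, PowerSeries.coeff_mk, mul_pow]

lemma EvalsTo.prod {f : ℕ → PowerSeries ℝ} {x : ℝ} {v : ℕ → ℝ} (h : ∀ j, EvalsTo (f j) x (v j))
    (n : ℕ) : EvalsTo (∏ j ∈ Finset.range n, f j) x (∏ j ∈ Finset.range n, v j) := by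
  induction n with
  | zero => simpa using evalsTo_one x
  | succ n ih =>
    rw [Finset.prod_range_succ, Finset.prod_range_succ]
    exact ih.mul (h n)

lemma evalsTo_tGen (n : ℕ) (x : ℝ) :
    EvalsTo (tGen n) x (∏ j ∈ Finset.range n, (1 + oddInv j * x)) :=
  EvalsTo.prod (fun j => evalsTo_linear (oddInv j) x) n

lemma evalsTo_tStarGen (n : ℕ) {x : ℝ} (hx : |x| < 1) :
    EvalsTo (tStarGen n) x (∏ j ∈ Finset.range n, (1 - oddInv j * x)⁻¹) := by
  refine EvalsTo.prod (fun j => evalsTo_geomSeries ?_) n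
  rw [abs_mul, abs_of_pos (oddInv_pos j)]
  exact (mul_le_of_le_one_left (abs_nonneg x) (oddInv_le_one j)).trans_lt hx

/-! ### Comparing coefficients of sums of power series -/

/-- A form of Raabe's test. -/
lemma summable_of_raabe {f : ℕ → ℝ} (h0 : ∀ n, 0 ≤ f n)
    (h : ∀ n : ℕ, f n / 8 ≤ ((n : ℝ) + 1) * f n - ((n : ℝ) + 2) * f (n + 1)) : Summable f := by
  refine summable_of_sum_range_le (c := 8 * f 0) h0 fun N => ?_
  have key : ∀ N : ℕ, ∑ n ∈ Finset.range N, f n / 8 ≤ f 0 - ((N : ℝ) + 1) * f N := by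
    intro N
    induction N with
    | zero => simp
    | succ N ih =>
      rw [Finset.sum_range_succ]
      push_cast
      have := h N
      linarith
  have h1 := key N
  have h2 : 0 ≤ ((N : ℝ) + 1) * f N := mul_nonneg (by positivity) (h0 N)
  rw [← Finset.sum_div] at h1
  linarith

/-- A series of power series with nonnegative coefficients that converges at `1 / 2` may be summed
coefficientwise on `[-1/2, 1/2]`. -/
lemma hasSum_tsum_coeff {f : ℕ → PowerSeries ℝ} {p : ℕ → ℝ}
    (h0 : ∀ n m, 0 ≤ PowerSeries.coeff m (f n)) (hp : ∀ n, EvalsTo (f n) (1 / 2) (p n))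
    (hps : Summable p) :
    (∀ m, Summable fun n => PowerSeries.coeff m (f n)) ∧
    ∀ (x : ℝ) (v : ℕ → ℝ), |x| ≤ 1 / 2 → (∀ n, EvalsTo (f n) x (v n)) →
      Summable v ∧
        HasSum (fun m => (∑' n, PowerSeries.coeff m (f n)) * x ^ m) (∑' n, v n) := by
  have hS : Summable fun z : ℕ × ℕ => PowerSeries.coeff z.2 (f z.1) * (1 / 2 : ℝ) ^ z.2 := by
    refine (summable_prod_of_nonneg fun z => mul_nonneg (h0 _ _) (by positivity)).2
      ⟨fun n => (hp n).summable, ?_⟩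
    refine hps.congr fun n => ((hp n).tsum_eq).symm
  have hcol : ∀ m, Summable fun n => PowerSeries.coeff m (f n) := fun m => by
    have h1 := (hS.prod_symm.prod_factor m).mul_right ((2 : ℝ) ^ m)
    refine h1.congr fun n => ?_
    simp only [Prod.swap_prod_mk]
    rw [mul_assoc, ← mul_pow]
    norm_num
  refine ⟨hcol, fun x v hx hv => ?_⟩
  have hSx : Summable fun z : ℕ × ℕ => PowerSeries.coeff z.2 (f z.1) * x ^ z.2 := by
    refine Summable.of_norm_bounded hS fun z => ?_
    rw [norm_mul, norm_pow, Real.norm_eq_abs, Real.norm_eq_abs, abs_of_nonneg (h0 _ _)]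
    exact mul_le_mul_of_nonneg_left (pow_le_pow_left₀ (abs_nonneg x) hx _) (h0 _ _)
  have hv' : ∀ n, ∑' m, PowerSeries.coeff m (f n) * x ^ m = v n := fun n => (hv n).tsum_eq
  refine ⟨hSx.prod.congr fun n => hv' n, ?_⟩
  have h2 := hSx.prod_symm.hasSum.prod_fiberwise fun m => ((hcol m).hasSum.mul_right (x ^ m))
  convert! h2 using 1
  rw [hSx.prod_symm.tsum_prod]
  exact (tsum_congr fun n => (hv' n).symm).trans
    (Summable.tsum_comm (f := fun n m => PowerSeries.coeff m (f n) * x ^ m) hSx).symm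

/-- A power series that converges on `[-1/2, 1/2]` and vanishes on `(-1/2, 0)` is zero. -/
lemma coeff_eq_zero_of_hasSum_zero {d : ℕ → ℝ} (hs : Summable fun m => d m * (1 / 2 : ℝ) ^ m)
    (h : ∀ x ∈ Set.Ioo (-(1 / 2) : ℝ) 0, HasSum (fun m => d m * x ^ m) 0) (m : ℕ) : d m = 0 := by
  set p := FormalMultilinearSeries.ofScalars ℝ d with hp
  have hr : ((1 / 2 : NNReal) : ENNReal) ≤ p.radius := by
    refine p.le_radius_of_summable_norm ?_
    refine hs.norm.congr fun n => ?_
    rw [hp, FormalMultilinearSeries.ofScalars_norm, norm_mul, norm_pow]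
    norm_num
  have hr0 : 0 < p.radius := lt_of_lt_of_le (by norm_num) hr
  have hF := (p.hasFPowerSeriesOnBall hr0).hasFPowerSeriesAt
  by_contra hm
  have hp0 : p ≠ 0 := fun h0 =>
    hm (congrFun (FormalMultilinearSeries.ofScalars_series_eq_zero (E := ℝ).1 h0) m)
  have h1 := hF.locally_ne_zero hp0
  have h2 : ∀ᶠ z in 𝓝[<] (0 : ℝ), p.sum z ≠ 0 :=
    h1.filter_mono (nhdsWithin_mono _ fun z hz => ne_of_lt hz)
  have h3 : ∀ᶠ z in 𝓝[<] (0 : ℝ), z ∈ Set.Ioo (-(1 / 2) : ℝ) 0 :=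
    Ioo_mem_nhdsLT (by norm_num)
  obtain ⟨z, hz, hz'⟩ := (h2.and h3).exists
  refine hz ?_
  have h4 := (h z hz').tsum_eq
  rw [FormalMultilinearSeries.sum, ← h4]
  refine tsum_congr fun n => ?_
  rw [hp, FormalMultilinearSeries.ofScalars_apply_eq, smul_eq_mul]

/-! ### The two generating functions -/

/-- The `n`-th summand of the generating function of the central binomial sums. -/
noncomputable def binomTerm (n : ℕ) : PowerSeries ℝ :=
  PowerSeries.C (1 / (4 : ℝ) ^ n * ((2 * n).choose n : ℝ) * oddInv n) * tStarGen (n + 1)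

/-- The `n`-th summand of the generating function of the sums
`∑_k ∑_n t_n(1_k) t⋆_{n+1}(1_{m-k}) / (2n+1)²`. -/
noncomputable def convTerm (n : ℕ) : PowerSeries ℝ :=
  PowerSeries.C (oddInv n ^ 2) * (tGen n * tStarGen (n + 1))

lemma EvalsTo.C_mul {f : PowerSeries ℝ} {x v : ℝ} (c : ℝ) (h : EvalsTo f x v) :
    EvalsTo (PowerSeries.C c * f) x (c * v) := by
  have h1 := HasSum.mul_left c h
  unfold EvalsTo
  convert! h1 using 2 with m
  rw [PowerSeries.coeff_C_mul, mul_assoc]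

/-- The value of `binomTerm n` at `x`, for `|x| < 1`. -/
noncomputable def binomVal (x : ℝ) (n : ℕ) : ℝ :=
  1 / (4 : ℝ) ^ n * ((2 * n).choose n : ℝ) * oddInv n *
    ∏ j ∈ Finset.range (n + 1), (1 - oddInv j * x)⁻¹

/-- The value of `convTerm n` at `x`, for `|x| < 1`. -/
noncomputable def convVal (x : ℝ) (n : ℕ) : ℝ :=
  oddInv n ^ 2 * ((∏ j ∈ Finset.range n, (1 + oddInv j * x)) *
    ∏ j ∈ Finset.range (n + 1), (1 - oddInv j * x)⁻¹)

lemma evalsTo_binomTerm {x : ℝ} (hx : |x| < 1) (n : ℕ) :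
    EvalsTo (binomTerm n) x (binomVal x n) :=
  (evalsTo_tStarGen (n + 1) hx).C_mul _

lemma evalsTo_convTerm {x : ℝ} (hx : |x| < 1) (n : ℕ) :
    EvalsTo (convTerm n) x (convVal x n) :=
  ((evalsTo_tGen n x).mul (evalsTo_tStarGen (n + 1) hx)).C_mul _

lemma coeff_binomTerm (n m : ℕ) : PowerSeries.coeff m (binomTerm n) =
    1 / (4 : ℝ) ^ n * ((2 * n).choose n : ℝ) * (tStarSum (ones m) (n + 1) / (2 * (n : ℝ) + 1)) := by
  rw [binomTerm, PowerSeries.coeff_C_mul, coeff_tStarGen, oddInv]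
  ring

lemma coeff_convTerm (n m : ℕ) : PowerSeries.coeff m (convTerm n) =
    ∑ k ∈ Finset.range (m + 1),
      tSum (ones k) n * tStarSum (ones (m - k)) (n + 1) / (2 * (n : ℝ) + 1) ^ 2 := by
  rw [convTerm, PowerSeries.coeff_C_mul, coeff_tGen_mul_tStarGen, Finset.mul_sum]
  refine Finset.sum_congr rfl fun k _ => ?_
  rw [oddInv, one_div_pow]
  ring

lemma coeff_binomTerm_nonneg (n m : ℕ) : 0 ≤ PowerSeries.coeff m (binomTerm n) := by
  rw [coeff_binomTerm]
  have := tStarSum_ones_nonneg m (n + 1)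
  positivity

lemma convTerm_summand_nonneg (n m k : ℕ) :
    0 ≤ tSum (ones k) n * tStarSum (ones (m - k)) (n + 1) / (2 * (n : ℝ) + 1) ^ 2 := by
  have := tStarSum_ones_nonneg (m - k) (n + 1)
  have := tSum_nonneg (ones k) n
  positivity

lemma coeff_convTerm_nonneg (n m : ℕ) : 0 ≤ PowerSeries.coeff m (convTerm n) := by
  rw [coeff_convTerm]
  exact Finset.sum_nonneg fun k _ => convTerm_summand_nonneg n m k

lemma centralBinom_ratio (n : ℕ) :
    1 / (4 : ℝ) ^ (n + 1) * ((2 * (n + 1)).choose (n + 1) : ℝ) =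
      1 / (4 : ℝ) ^ n * ((2 * n).choose n : ℝ) * ((2 * n + 1) / (2 * (n + 1))) := by
  have h3 : ((n : ℝ) + 1) * ((n + 1).centralBinom : ℝ) =
      2 * (2 * n + 1) * (n.centralBinom : ℝ) := by
    exact_mod_cast Nat.succ_mul_centralBinom_succ n
  rw [← Nat.centralBinom_eq_two_mul_choose, ← Nat.centralBinom_eq_two_mul_choose, pow_succ]
  field_simp
  linear_combination 2 * h3

lemma one_sub_half_oddInv (n : ℕ) :
    1 - oddInv n * (1 / 2) = (4 * n + 1) / (4 * n + 2) := by
  unfold oddInv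
  field_simp
  ring

lemma one_sub_half_oddInv_pos (n : ℕ) : 0 < 1 - oddInv n * (1 / 2) := by
  rw [one_sub_half_oddInv]
  positivity

lemma binomVal_half_nonneg (n : ℕ) : 0 ≤ binomVal (1 / 2) n := by
  unfold binomVal
  have := oddInv_pos n
  have : 0 ≤ ∏ j ∈ Finset.range (n + 1), (1 - oddInv j * (1 / 2))⁻¹ :=
    Finset.prod_nonneg fun j _ => (inv_pos.2 (one_sub_half_oddInv_pos j)).le
  positivity

lemma summable_binomVal_half : Summable (binomVal (1 / 2)) := by
  refine summable_of_raabe binomVal_half_nonneg fun n => ?_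
  have h : binomVal (1 / 2) (n + 1) =
      binomVal (1 / 2) n * ((2 * n + 1) ^ 2 / ((n + 1) * (4 * n + 5))) := by
    unfold binomVal
    rw [Finset.prod_range_succ _ (n + 1), centralBinom_ratio, one_sub_half_oddInv (n + 1)]
    unfold oddInv
    push_cast
    field_simp
    ring
  have h1 : 1 / 8 ≤ ((n : ℝ) + 1) - (n + 2) * ((2 * n + 1) ^ 2 / ((n + 1) * (4 * n + 5))) := by
    have hn : (0 : ℝ) ≤ n := Nat.cast_nonneg n
    rw [le_sub_iff_add_le, ← le_sub_iff_add_le', ← mul_div_assoc, div_le_iff₀ (by positivity)]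
    nlinarith [mul_nonneg hn hn]
  rw [h]
  have h2 := mul_le_mul_of_nonneg_left h1 (binomVal_half_nonneg n)
  linarith

lemma convVal_half_nonneg (n : ℕ) : 0 ≤ convVal (1 / 2) n := by
  unfold convVal
  have h1 : 0 ≤ ∏ j ∈ Finset.range (n + 1), (1 - oddInv j * (1 / 2))⁻¹ :=
    Finset.prod_nonneg fun j _ => (inv_pos.2 (one_sub_half_oddInv_pos j)).le
  have h2 : 0 ≤ ∏ j ∈ Finset.range n, (1 + oddInv j * (1 / 2)) :=
    Finset.prod_nonneg fun j _ => by have := oddInv_pos j; positivity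
  positivity

lemma summable_convVal_half : Summable (convVal (1 / 2)) := by
  refine summable_of_raabe convVal_half_nonneg fun n => ?_
  have h : convVal (1 / 2) (n + 1) =
      convVal (1 / 2) n * ((2 * n + 1) * (4 * n + 3) / ((2 * n + 3) * (4 * n + 5))) := by
    unfold convVal
    rw [Finset.prod_range_succ _ (n + 1), Finset.prod_range_succ (fun j => 1 + _),
      one_sub_half_oddInv (n + 1)]
    unfold oddInv
    push_cast
    field_simp
    ring
  have h1 : 1 / 8 ≤ ((n : ℝ) + 1) -
      (n + 2) * ((2 * n + 1) * (4 * n + 3) / ((2 * n + 3) * (4 * n + 5))) := by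
    have hn : (0 : ℝ) ≤ n := Nat.cast_nonneg n
    rw [le_sub_iff_add_le, ← le_sub_iff_add_le', ← mul_div_assoc, div_le_iff₀ (by positivity)]
    nlinarith [mul_nonneg hn hn]
  rw [h]
  have h2 := mul_le_mul_of_nonneg_left h1 (convVal_half_nonneg n)
  linarith

/-- `binomVal (-a) n` and the moments `∫ sin^{2n} θ cos^{a+1} θ` satisfy the same recurrence. -/
lemma binomVal_neg {a : ℝ} (ha : 0 < a) (n : ℕ) :
    binomVal (-a) n =
      1 / (4 : ℝ) ^ n * ((2 * n).choose n : ℝ) * sinMoment a n / ((1 + a) * sinMoment a 0) := by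
  have hJ := (sinMoment_zero_pos ha).ne'
  have key : oddInv n * ∏ j ∈ Finset.range (n + 1), (1 - oddInv j * -a)⁻¹ =
      sinMoment a n / ((1 + a) * sinMoment a 0) := by
    induction n with
    | zero => simp [oddInv]; field_simp
    | succ n ih =>
      have h := sinMoment_succ ha n
      have h1 : (2 * (n : ℝ) + 3 + a) ≠ 0 := by positivity
      have h2 : sinMoment a (n + 1) = (2 * (n : ℝ) + 1) / (2 * n + 3 + a) * sinMoment a n := by
        field_simp
        linarith
      have h3 : oddInv (n + 1) * (1 - oddInv (n + 1) * -a)⁻¹ =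
          (2 * (n : ℝ) + 1) / (2 * n + 3 + a) * oddInv n := by
        unfold oddInv
        push_cast
        have h4 : 1 - 1 / (2 * ((n : ℝ) + 1) + 1) * -a =
            (2 * n + 3 + a) / (2 * ((n : ℝ) + 1) + 1) := by
          field_simp
          ring
        rw [h4]
        field_simp
      rw [Finset.prod_range_succ, h2, mul_div_assoc, ← ih]
      linear_combination (∏ j ∈ Finset.range (n + 1), (1 - oddInv j * -a)⁻¹) * h3
  rw [binomVal, mul_assoc, key]
  ring

/-- `convVal (-a) n` and the Fourier coefficients of `cos^a` satisfy the same recurrence. -/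
lemma convVal_neg {a : ℝ} (ha : 0 < a) (n : ℕ) :
    convVal (-a) n = (-1 : ℝ) ^ n * cosCoeff a n / (2 * n + 1) / ((1 + a) * sinMoment a 0) := by
  have hJ := (sinMoment_zero_pos ha).ne'
  have key : oddInv n * ((∏ j ∈ Finset.range n, (1 + oddInv j * -a)) *
      ∏ j ∈ Finset.range (n + 1), (1 - oddInv j * -a)⁻¹) =
      (-1 : ℝ) ^ n * cosCoeff a n / ((1 + a) * sinMoment a 0) := by
    induction n with
    | zero => simp [oddInv, cosCoeff_zero ha]; field_simp
    | succ n ih =>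
      have h := cosCoeff_succ ha n
      have h1 : (2 * (n : ℝ) + 3 + a) ≠ 0 := by positivity
      have h2 : cosCoeff a (n + 1) =
          -((2 * (n : ℝ) + 1 - a) / (2 * n + 3 + a) * cosCoeff a n) := by
        field_simp
        linarith
      have h3 : oddInv (n + 1) * ((1 + oddInv n * -a) * (1 - oddInv (n + 1) * -a)⁻¹) =
          (2 * (n : ℝ) + 1 - a) / (2 * n + 3 + a) * oddInv n := by
        unfold oddInv
        push_cast
        have h4 : 1 - 1 / (2 * ((n : ℝ) + 1) + 1) * -a =
            (2 * n + 3 + a) / (2 * ((n : ℝ) + 1) + 1) := by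
          field_simp
          ring
        rw [h4]
        field_simp
        ring
      have h5 : (-1 : ℝ) ^ (n + 1) * cosCoeff a (n + 1) / ((1 + a) * sinMoment a 0) =
          (2 * (n : ℝ) + 1 - a) / (2 * n + 3 + a) *
            ((-1 : ℝ) ^ n * cosCoeff a n / ((1 + a) * sinMoment a 0)) := by
        rw [h2, pow_succ]
        ring
      rw [h5, ← ih, Finset.prod_range_succ _ (n + 1), Finset.prod_range_succ (fun j => 1 + _)]
      linear_combination ((∏ j ∈ Finset.range n, (1 + oddInv j * -a)) *
        ∏ j ∈ Finset.range (n + 1), (1 - oddInv j * -a)⁻¹) * h3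
  rw [convVal, pow_two, mul_assoc, key, oddInv]
  ring

lemma summable_coeff_binomTerm (m : ℕ) : Summable fun n => PowerSeries.coeff m (binomTerm n) :=
  (hasSum_tsum_coeff coeff_binomTerm_nonneg
    (evalsTo_binomTerm (by rw [abs_of_pos] <;> norm_num)) summable_binomVal_half).1 m

lemma hasSum_tsum_coeff_binomTerm {x : ℝ} (hx : |x| ≤ 1 / 2) : Summable (binomVal x) ∧
    HasSum (fun m => (∑' n, PowerSeries.coeff m (binomTerm n)) * x ^ m) (∑' n, binomVal x n) :=
  (hasSum_tsum_coeff coeff_binomTerm_nonneg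
    (evalsTo_binomTerm (by rw [abs_of_pos] <;> norm_num)) summable_binomVal_half).2 x _ hx
    (evalsTo_binomTerm (by linarith))

lemma summable_coeff_convTerm (m : ℕ) : Summable fun n => PowerSeries.coeff m (convTerm n) :=
  (hasSum_tsum_coeff coeff_convTerm_nonneg
    (evalsTo_convTerm (by rw [abs_of_pos] <;> norm_num)) summable_convVal_half).1 m

lemma hasSum_tsum_coeff_convTerm {x : ℝ} (hx : |x| ≤ 1 / 2) : Summable (convVal x) ∧
    HasSum (fun m => (∑' n, PowerSeries.coeff m (convTerm n)) * x ^ m) (∑' n, convVal x n) :=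
  (hasSum_tsum_coeff coeff_convTerm_nonneg
    (evalsTo_convTerm (by rw [abs_of_pos] <;> norm_num)) summable_convVal_half).2 x _ hx
    (evalsTo_convTerm (by linarith))

/-- Both generating functions are multiples of `∫₀^{π/2} cos^a` at `x = -a`. -/
lemma tsum_binomVal_neg {a : ℝ} (ha : 0 < a) (ha' : a < 1 / 2) :
    ∑' n, binomVal (-a) n = 4 / Real.pi * ∑' n, convVal (-a) n := by
  have hx' : |(-a)| ≤ 1 / 2 := by rw [abs_neg, abs_of_pos ha]; linarith
  have h1 : ∑' n, binomVal (-a) n = cosIntegral a / ((1 + a) * sinMoment a 0) := by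
    rw [tsum_congr (binomVal_neg ha)]
    exact ((hasSum_sinMoment ha).div_const _).tsum_eq
  have hs : Summable (convVal (-a)) :=
    (hasSum_tsum_coeff_convTerm hx').1
  have h2 : ∑' n, convVal (-a) n =
      Real.pi / 4 * cosIntegral a / ((1 + a) * sinMoment a 0) := by
    refine tendsto_nhds_unique hs.hasSum.tendsto_sum_nat ?_
    refine ((tendsto_sum_cosCoeff ha).div_const _).congr fun N => ?_
    rw [Finset.sum_div]
    exact Finset.sum_congr rfl fun n _ => (convVal_neg ha n).symm
  rw [h1, h2]
  have := Real.pi_pos.ne'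
  field_simp

/-- The first equality of the theorem: the generating functions agree up to the factor `4 / π` on
`(-1/2, 0)`, hence so do their coefficients. -/
lemma tsum_coeff_binomTerm (m : ℕ) :
    ∑' n, PowerSeries.coeff m (binomTerm n) =
      4 / Real.pi * ∑' n, PowerSeries.coeff m (convTerm n) := by
  have hs : ∀ x : ℝ, |x| ≤ 1 / 2 → HasSum (fun m => (∑' n, PowerSeries.coeff m (binomTerm n) -
      4 / Real.pi * ∑' n, PowerSeries.coeff m (convTerm n)) * x ^ m)
      (∑' n, binomVal x n - 4 / Real.pi * ∑' n, convVal x n) := fun x hx => by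
    have h1 := (hasSum_tsum_coeff_binomTerm hx).2
    have h2 := (hasSum_tsum_coeff_convTerm hx).2
    convert! h1.sub (h2.mul_left (4 / Real.pi)) using 2 with m
    ring
  refine sub_eq_zero.1 (coeff_eq_zero_of_hasSum_zero
    (hs (1 / 2) (by norm_num [abs_of_pos])).summable (fun x hx => ?_) m)
  have h := hs x (by rw [abs_of_neg hx.2]; linarith [hx.1])
  have h2 := tsum_binomVal_neg (a := -x) (by linarith [hx.2]) (by linarith [hx.1])
  rw [neg_neg] at h2
  rwa [h2, sub_self] at h

/-! ### Multiple `t`-values as colored multiple zeta values -/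

lemma coloredSum_cons_succ (p : ℕ × ℂ) (ps : List (ℕ × ℂ)) (n : ℕ) :
    coloredSum (p :: ps) (n + 1) = coloredSum (p :: ps) n +
      p.2 ^ (n + 1) / ((n : ℂ) + 1) ^ p.1 * coloredSum ps n := by
  simp only [coloredSum]
  rw [Finset.sum_Icc_succ_top (by omega)]
  push_cast
  rfl

lemma coloredSum_cons_zero (p : ℕ × ℂ) (ps : List (ℕ × ℂ)) : coloredSum (p :: ps) 0 = 0 := by
  simp [coloredSum]

lemma coloredSum_cons_eq_sum_range (p : ℕ × ℂ) (ps : List (ℕ × ℂ)) (n : ℕ) :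
    coloredSum (p :: ps) n =
      ∑ j ∈ Finset.range n, p.2 ^ (j + 1) / ((j : ℂ) + 1) ^ p.1 * coloredSum ps j := by
  induction n with
  | zero => simp [coloredSum_cons_zero]
  | succ n ih => rw [coloredSum_cons_succ, Finset.sum_range_succ, ih]

lemma norm_coloredSum_step {z : ℂ} (hz : z ^ 2 = 1) (k j : ℕ) :
    ‖z ^ (j + 1) / ((j : ℂ) + 1) ^ k‖ = 1 / ((j : ℝ) + 1) ^ k := by
  have h1 : ‖z‖ = 1 := Complex.norm_eq_one_of_pow_eq_one hz two_ne_zero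
  have h2 : ‖(j : ℂ) + 1‖ = (j : ℝ) + 1 := by
    rw [← Nat.cast_succ, Complex.norm_natCast, Nat.cast_succ]
  rw [norm_div, norm_pow, norm_pow, h1, h2, one_pow]

/-- Colored sums of level two grow at most like `√n`, which suffices for the convergence of
`∑ n⁻² coloredSum l n`. -/
lemma norm_coloredSum_le (l : List (ℕ × ℂ)) (hl : ∀ p ∈ l, 1 ≤ p.1 ∧ p.2 ^ 2 = 1) :
    ∀ n : ℕ, ‖coloredSum l n‖ ≤ 3 ^ l.length * √((n : ℝ) + 1) := by
  induction l with
  | nil =>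
    intro n
    simp [coloredSum]
  | cons p ps ih =>
    have ih' := ih fun q hq => hl q (List.mem_cons_of_mem _ hq)
    obtain ⟨hp1, hp2⟩ := hl p List.mem_cons_self
    intro n
    induction n with
    | zero =>
      rw [coloredSum_cons_zero, norm_zero]
      positivity
    | succ n ihn =>
      rw [coloredSum_cons_succ]
      refine (norm_add_le _ _).trans ?_
      rw [norm_mul, norm_coloredSum_step hp2]
      push_cast
      have hs0 : (1 : ℝ) ≤ (n : ℝ) + 1 := by linarith [(Nat.cast_nonneg n : (0 : ℝ) ≤ n)]
      set s := √((n : ℝ) + 1) with hs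
      set t := √((n : ℝ) + 1 + 1) with ht
      have hs2 : s ^ 2 = (n : ℝ) + 1 := Real.sq_sqrt (by linarith)
      have ht2 : t ^ 2 = (n : ℝ) + 1 + 1 := Real.sq_sqrt (by linarith)
      have hspos : 0 < s := Real.sqrt_pos.2 (by linarith)
      have htpos : 0 < t := Real.sqrt_pos.2 (by linarith)
      -- With `t² = s² + 1` and `s ≥ 1` this is `s⁴ + (2/3) s² + 1/9 ≤ s⁴ + s²`; it is what makes
      -- the growth factor `3` per entry sufficient.
      have h1 : s ^ 2 + 1 / 3 ≤ s * t := by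
        refine le_of_sq_le_sq ?_ (by positivity)
        rw [mul_pow, ht2, ← hs2]
        nlinarith
      have h2 : 1 / ((n : ℝ) + 1) ^ p.1 ≤ 1 / s ^ 2 := by
        rw [hs2]
        exact one_div_le_one_div_of_le (by linarith) (le_self_pow₀ hs0 (by omega))
      have h3 : 1 / s ^ 2 * s ≤ 3 * (t - s) := by
        rw [div_mul_eq_mul_div, div_le_iff₀ (by positivity)]
        nlinarith
      have h4 : 1 / ((n : ℝ) + 1) ^ p.1 * ‖coloredSum ps n‖ ≤
          1 / s ^ 2 * (3 ^ ps.length * s) :=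
        mul_le_mul h2 (ih' n) (norm_nonneg _) (by positivity)
      have h5 : 1 / s ^ 2 * (3 ^ ps.length * s) ≤ 3 ^ ps.length * (3 * (t - s)) := by
        have := mul_le_mul_of_nonneg_left h3 (by positivity : (0 : ℝ) ≤ 3 ^ ps.length)
        linarith
      rw [List.length_cons, pow_succ] at ihn ⊢
      linarith

/-- Colored sums of level two with leading exponent at least `2` converge. -/
lemma exists_tendsto_coloredSum (l : List (ℕ × ℂ)) (hl : ∀ p ∈ l, 1 ≤ p.1 ∧ p.2 ^ 2 = 1)
    (hl2 : AdmissibleIndex (l.map Prod.fst)) : ∃ y, Tendsto (coloredSum l) atTop (𝓝 y) := by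
  cases l with
  | nil => exact ⟨1, tendsto_const_nhds⟩
  | cons p ps =>
    have hp : 2 ≤ p.1 := hl2 p.1 (by simp)
    obtain ⟨-, hp2⟩ := hl p List.mem_cons_self
    have hb := norm_coloredSum_le ps fun q hq => hl q (List.mem_cons_of_mem _ hq)
    have hsum : Summable fun j : ℕ =>
        p.2 ^ (j + 1) / ((j : ℂ) + 1) ^ p.1 * coloredSum ps j := by
      have h1 : Summable fun j : ℕ => 3 ^ ps.length * (1 / ((j + 1 : ℕ) : ℝ) ^ (3 / 2 : ℝ)) :=
        ((summable_nat_add_iff 1).2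
          (Real.summable_one_div_nat_rpow.2 (by norm_num))).mul_left _
      refine Summable.of_norm_bounded h1 fun j => ?_
      rw [norm_mul, norm_coloredSum_step hp2]
      have hj : (1 : ℝ) ≤ (j : ℝ) + 1 := by linarith [(Nat.cast_nonneg j : (0 : ℝ) ≤ j)]
      have h2 : 1 / ((j : ℝ) + 1) ^ p.1 ≤ 1 / ((j : ℝ) + 1) ^ 2 :=
        one_div_le_one_div_of_le (by positivity) (pow_le_pow_right₀ hj hp)
      refine (mul_le_mul h2 (hb j) (norm_nonneg _) (by positivity)).trans_eq ?_
      have h3 : ((j : ℝ) + 1) ^ 2 = ((j : ℝ) + 1) ^ (3 / 2 : ℝ) * √((j : ℝ) + 1) := by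
        rw [Real.sqrt_eq_rpow, ← Real.rpow_add (by linarith), ← Real.rpow_natCast]
        norm_num
      have h4 : 0 < √((j : ℝ) + 1) := Real.sqrt_pos.2 (by linarith)
      have h5 : 0 < ((j : ℝ) + 1) ^ (3 / 2 : ℝ) := Real.rpow_pos_of_pos (by linarith) _
      push_cast
      rw [h3]
      field_simp
    refine ⟨_, hsum.hasSum.tendsto_sum_nat.congr fun n => ?_⟩
    rw [coloredSum_cons_eq_sum_range]

/-- The `ℚ`-linear operator on sequences that prepends an exponent `k` to a multiple `t`-harmonic
sum. -/
noncomputable def prependOdd (k : ℕ) : (ℕ → ℂ) →ₗ[ℚ] (ℕ → ℂ) where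
  toFun u n := ∑ j ∈ Finset.range n, (oddInv j : ℂ) ^ k * u j
  map_add' u v := by
    funext n
    simp [mul_add, Finset.sum_add_distrib]
  map_smul' q u := by
    funext n
    simp [Finset.smul_sum]

/-- The colored sums of level two with exponents `ks`, sampled at even truncations. -/
def evenColoredSums (ks : List ℕ) : Set (ℕ → ℂ) :=
  {u | ∃ l : List (ℕ × ℂ), (∀ p ∈ l, p.2 ^ 2 = 1) ∧ l.map Prod.fst = ks ∧
    u = fun n => coloredSum l (2 * n)}

/-- The indicator function `(1 - (-1)^i) / 2` of the odd numbers expresses a sum over odd indices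
through two colored sums. -/
lemma prependOdd_coloredSum (k : ℕ) (ps : List (ℕ × ℂ)) :
    prependOdd k (fun n => coloredSum ps (2 * n)) =
      (1 / 2 : ℚ) • ((fun n => coloredSum ((k, 1) :: ps) (2 * n)) -
        fun n => coloredSum ((k, -1) :: ps) (2 * n)) := by
  funext n
  simp only [Pi.smul_apply, Pi.sub_apply, Rat.smul_def]
  change ∑ j ∈ Finset.range n, (oddInv j : ℂ) ^ k * coloredSum ps (2 * j) = _
  induction n with
  | zero => simp [coloredSum_cons_zero]
  | succ n ih =>
    rw [Finset.sum_range_succ, ih, show 2 * (n + 1) = 2 * n + 1 + 1 by ring,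
      coloredSum_cons_succ, coloredSum_cons_succ, coloredSum_cons_succ, coloredSum_cons_succ]
    have e1 : (-1 : ℂ) ^ (2 * n + 1) = -1 := Odd.neg_one_pow ⟨n, rfl⟩
    have e2 : (-1 : ℂ) ^ (2 * n + 1 + 1) = 1 := Even.neg_one_pow ⟨n + 1, by ring⟩
    simp only [e1, e2, one_pow, oddInv]
    push_cast
    rw [one_div_pow]
    ring

/-- As functions of the truncation, multiple `t`-harmonic sums are rational combinations of colored
sums of level two. -/
lemma tSum_mem_span (ks : List ℕ) :
    (fun n => ((tSum ks n : ℝ) : ℂ)) ∈ Submodule.span ℚ (evenColoredSums ks) := by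
  induction ks with
  | nil => exact Submodule.subset_span ⟨[], by simp, rfl, by simp [tSum, coloredSum]⟩
  | cons k ks ih =>
    have h : (fun n => ((tSum (k :: ks) n : ℝ) : ℂ)) =
        prependOdd k fun n => ((tSum ks n : ℝ) : ℂ) := by
      funext n
      rw [tSum_cons_eq_sum_range]
      push_cast
      rfl
    rw [h]
    refine Submodule.span_induction (p := fun u _ =>
      prependOdd k u ∈ Submodule.span ℚ (evenColoredSums (k :: ks))) ?_ ?_ ?_ ?_ ih
    · rintro u ⟨l, hl, rfl, rfl⟩
      rw [prependOdd_coloredSum]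
      refine Submodule.smul_mem _ _ (Submodule.sub_mem _ ?_ ?_)
      · refine Submodule.subset_span ⟨(k, 1) :: l, ?_, rfl, rfl⟩
        intro p hp
        rcases List.mem_cons.1 hp with rfl | hp
        · simp
        · exact hl p hp
      · refine Submodule.subset_span ⟨(k, -1) :: l, ?_, rfl, rfl⟩
        intro p hp
        rcases List.mem_cons.1 hp with rfl | hp
        · simp
        · exact hl p hp
    · rw [map_zero]
      exact Submodule.zero_mem _
    · intro u v _ _ hu hv
      rw [map_add]
      exact Submodule.add_mem _ hu hv
    · intro q u _ hu
      rw [map_smul]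
      exact Submodule.smul_mem _ _ hu

/-- Every admissible multiple `t`-value is a combination of colored multiple zeta values of level
two and the same weight. -/
lemma ofReal_mem_CMZV {ks : List ℕ} (hpos : ∀ k ∈ ks, 1 ≤ k) (hadm : AdmissibleIndex ks) {x : ℝ}
    (hx : Tendsto (tSum ks) atTop (𝓝 x)) : (x : ℂ) ∈ CMZV 2 ks.sum := by
  have key : ∀ u ∈ Submodule.span ℚ (evenColoredSums ks),
      ∃ y ∈ CMZV 2 ks.sum, Tendsto u atTop (𝓝 y) := by
    intro u hu
    refine Submodule.span_induction (p := fun u _ =>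
      ∃ y ∈ CMZV 2 ks.sum, Tendsto u atTop (𝓝 y)) ?_ ?_ ?_ ?_ hu
    · rintro u ⟨l, hl, rfl, rfl⟩
      have hl' : ∀ p ∈ l, 1 ≤ p.1 ∧ p.2 ^ 2 = 1 := fun p hp =>
        ⟨hpos p.1 (List.mem_map_of_mem hp), hl p hp⟩
      obtain ⟨y, hy⟩ := exists_tendsto_coloredSum l hl' hadm
      refine ⟨y, Submodule.subset_span ⟨l, hl', rfl, ?_, hy⟩, ?_⟩
      · intro p hp h
        have h2 : 2 ≤ p.1 := hadm p.1 (by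
          rw [List.head?_map]
          exact Option.mem_map_of_mem _ hp)
        rw [h] at h2
        omega
      · exact hy.comp (tendsto_id.const_mul_atTop' (by norm_num))
    · exact ⟨0, Submodule.zero_mem _, tendsto_const_nhds⟩
    · rintro u v _ _ ⟨y, hy, hy'⟩ ⟨z, hz, hz'⟩
      exact ⟨y + z, Submodule.add_mem _ hy hz, hy'.add hz'⟩
    · rintro q u _ ⟨y, hy, hy'⟩
      exact ⟨q • y, Submodule.smul_mem _ _ hy, hy'.const_smul q⟩
  obtain ⟨y, hy, hy'⟩ := key _ (tSum_mem_span ks)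
  have hx' : Tendsto (fun n => ((tSum ks n : ℝ) : ℂ)) atTop (𝓝 (x : ℂ)) :=
    (Complex.continuous_ofReal.tendsto x).comp hx
  rwa [tendsto_nhds_unique hx' hy']

lemma ofReal_mem_CMZV_of_mem_MtV {w : ℕ} {x : ℝ} (hx : x ∈ MtV w) : (x : ℂ) ∈ CMZV 2 w := by
  refine Submodule.span_induction (p := fun (x : ℝ) _ => (x : ℂ) ∈ CMZV 2 w) ?_ ?_ ?_ ?_ hx
  · rintro x ⟨s, hs, hx⟩
    have h := ofReal_mem_CMZV (fun k hk => s.one_le_blocks hk) hs hx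
    rwa [s.blocks_sum] at h
  · simp
  · intro x y _ _ hx hy
    rw [Complex.ofReal_add]
    exact Submodule.add_mem _ hx hy
  · intro q x _ hx
    rw [Rat.smul_def, Complex.ofReal_mul, Complex.ofReal_ratCast, ← Rat.smul_def]
    exact Submodule.smul_mem _ _ hx

/-! ### Multiple `t`-values of admissible indices -/

lemma coeff_convTerm_eq_sum_admissible (n m : ℕ) :
    PowerSeries.coeff m (convTerm n) =
      ∑ s : Composition (m + 2) with AdmissibleIndex s.blocks,
        (2 : ℝ) ^ (s.blocks.length - 1) *
          (oddInv n ^ s.blocks.headI * tSum s.blocks.tail n) := by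
  rw [convTerm, PowerSeries.coeff_C_mul, mul_comm, coeff_div_sq_eq_sum_admissible]

lemma cons_headI_tail_blocks {m : ℕ} (s : Composition (m + 2)) :
    s.blocks.headI :: s.blocks.tail = s.blocks := by
  rcases h : s.blocks with _ | ⟨a, l⟩
  · exact absurd (s.blocks_eq_nil.1 h) (by omega)
  · rfl

lemma headI_term_nonneg (l : List ℕ) (n : ℕ) : 0 ≤ oddInv n ^ l.headI * tSum l.tail n :=
  mul_nonneg (pow_nonneg (oddInv_pos n).le _) (tSum_nonneg _ _)

lemma summable_admissible_term {m : ℕ} (s : Composition (m + 2)) (hs : AdmissibleIndex s.blocks) :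
    Summable fun n => oddInv n ^ s.blocks.headI * tSum s.blocks.tail n := by
  refine Summable.of_nonneg_of_le (headI_term_nonneg s.blocks) (fun n => ?_)
    (summable_coeff_convTerm m)
  rw [coeff_convTerm_eq_sum_admissible]
  refine le_trans ?_ (Finset.single_le_sum (f := fun s : Composition (m + 2) =>
    (2 : ℝ) ^ (s.blocks.length - 1) * (oddInv n ^ s.blocks.headI * tSum s.blocks.tail n))
    (fun t _ => mul_nonneg (by positivity) (headI_term_nonneg t.blocks n))
    (Finset.mem_filter.2 ⟨Finset.mem_univ s, hs⟩))
  exact le_mul_of_one_le_left (headI_term_nonneg s.blocks n) (one_le_pow₀ (by norm_num))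

lemma tendsto_tSum_tsum {m : ℕ} (s : Composition (m + 2)) (hs : AdmissibleIndex s.blocks) :
    Tendsto (tSum s.blocks) atTop
      (𝓝 (∑' n, oddInv n ^ s.blocks.headI * tSum s.blocks.tail n)) := by
  refine (summable_admissible_term s hs).hasSum.tendsto_sum_nat.congr fun n => ?_
  rw [← tSum_cons_eq_sum_range, cons_headI_tail_blocks]

lemma tValue_eq_tsum {m : ℕ} (s : Composition (m + 2)) (hs : AdmissibleIndex s.blocks) :
    tValue s.blocks = ∑' n, oddInv n ^ s.blocks.headI * tSum s.blocks.tail n :=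
  (tendsto_tSum_tsum s hs).limUnder_eq

lemma tendsto_tSum_tValue {m : ℕ} (s : Composition (m + 2)) (hs : AdmissibleIndex s.blocks) :
    Tendsto (tSum s.blocks) atTop (𝓝 (tValue s.blocks)) := by
  rw [tValue_eq_tsum s hs]
  exact tendsto_tSum_tsum s hs

lemma tsum_coeff_convTerm (m : ℕ) :
    ∑' n, PowerSeries.coeff m (convTerm n) =
      ∑ s : Composition (m + 2) with AdmissibleIndex s.blocks,
        (2 : ℝ) ^ (s.blocks.length - 1) * tValue s.blocks := by
  simp only [coeff_convTerm_eq_sum_admissible]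
  rw [Summable.tsum_finsetSum fun s hs =>
    (summable_admissible_term s (Finset.mem_filter.1 hs).2).mul_left _]
  refine Finset.sum_congr rfl fun s hs => ?_
  rw [tsum_mul_left, tValue_eq_tsum s (Finset.mem_filter.1 hs).2]

lemma length_mem_Icc {m : ℕ} (s : Composition (m + 2)) (hs : AdmissibleIndex s.blocks) :
    s.length ∈ Finset.Icc 1 (m + 1) := by
  have h1 : 0 < s.length := s.length_pos_iff.2 (by omega)
  -- A composition of `m + 2` into `m + 2` blocks is `(1, …, 1)`, which is not admissible.
  have h2 : s.length ≠ m + 2 := fun h => by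
    rw [← Composition.eq_ones_iff_length] at h
    have := hs 1 (by rw [h, Composition.ones_blocks, List.replicate_succ, List.head?_cons]; rfl)
    omega
  have h3 := s.length_le
  rw [Finset.mem_Icc]
  omega

lemma sum_admissible_by_length (m : ℕ) (f : Composition (m + 2) → ℝ) :
    ∑ d ∈ Finset.Icc 1 (m + 1),
        ∑ s : Composition (m + 2) with s.length = d ∧ AdmissibleIndex s.blocks,
          (2 : ℝ) ^ (d - 1) * f s =
      ∑ s : Composition (m + 2) with AdmissibleIndex s.blocks,
        (2 : ℝ) ^ (s.blocks.length - 1) * f s := by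
  rw [← Finset.sum_fiberwise_of_maps_to (t := Finset.Icc 1 (m + 1))
    (g := fun s : Composition (m + 2) => s.length)
    fun s hs => length_mem_Icc s (Finset.mem_filter.1 hs).2]
  refine Finset.sum_congr rfl fun d _ => ?_
  rw [Finset.filter_filter]
  refine Finset.sum_congr (Finset.filter_congr fun s _ => and_comm) fun s hs => ?_
  rw [Composition.blocks_length, (Finset.mem_filter.1 hs).2.2]

lemma summable_convTerm_summand {m k : ℕ} (hk : k ∈ Finset.range (m + 1)) :
    Summable fun n : ℕ =>
      tSum (ones k) n * tStarSum (ones (m - k)) (n + 1) / (2 * (n : ℝ) + 1) ^ 2 := by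
  refine Summable.of_nonneg_of_le (fun n => convTerm_summand_nonneg n m k) (fun n => ?_)
    (summable_coeff_convTerm m)
  rw [coeff_convTerm]
  exact Finset.single_le_sum (f := fun k =>
    tSum (ones k) n * tStarSum (ones (m - k)) (n + 1) / (2 * (n : ℝ) + 1) ^ 2)
    (fun k _ => convTerm_summand_nonneg n m k) hk

lemma sum_tsum_eq_tsum_coeff_convTerm (m : ℕ) :
    ∑ k ∈ Finset.range (m + 1), ∑' n : ℕ,
        tSum (ones k) n * tStarSum (ones (m - k)) (n + 1) / (2 * (n : ℝ) + 1) ^ 2 =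
      ∑' n, PowerSeries.coeff m (convTerm n) := by
  simp only [coeff_convTerm]
  rw [Summable.tsum_finsetSum fun k hk => summable_convTerm_summand hk]

theorem mainTheorem7 (m : ℕ) :
    -- all series and limits that occur converge
    Summable (fun n : ℕ =>
      1 / (4 : ℝ) ^ n * ((2 * n).choose n : ℝ) * (tStarSum (ones m) (n + 1) / (2 * (n : ℝ) + 1))) ∧
    (∀ k ∈ Finset.range (m + 1), Summable (fun n : ℕ =>
      tSum (ones k) n * tStarSum (ones (m - k)) (n + 1) / (2 * (n : ℝ) + 1) ^ 2)) ∧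
    (∀ s : Composition (m + 2), AdmissibleIndex s.blocks →
      Tendsto (tSum s.blocks) atTop (𝓝 (tValue s.blocks))) ∧
    -- the two equalities
    (∑' n : ℕ, 1 / (4 : ℝ) ^ n * ((2 * n).choose n : ℝ) *
        (tStarSum (ones m) (n + 1) / (2 * (n : ℝ) + 1))
      = 4 / Real.pi * ∑ k ∈ Finset.range (m + 1), ∑' n : ℕ,
          tSum (ones k) n * tStarSum (ones (m - k)) (n + 1) / (2 * (n : ℝ) + 1) ^ 2) ∧
    (4 / Real.pi * ∑ k ∈ Finset.range (m + 1), ∑' n : ℕ,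
          tSum (ones k) n * tStarSum (ones (m - k)) (n + 1) / (2 * (n : ℝ) + 1) ^ 2
      = 4 / Real.pi * ∑ d ∈ Finset.Icc 1 (m + 1),
          ∑ s : Composition (m + 2) with s.length = d ∧ AdmissibleIndex s.blocks,
            (2 : ℝ) ^ (d - 1) * tValue s.blocks) ∧
    -- the common value lies in `(1/π) MtV_{m+2}`, which is contained in `(1/π) CMZV²_{m+2}`
    (∑' n : ℕ, 1 / (4 : ℝ) ^ n * ((2 * n).choose n : ℝ) *
        (tStarSum (ones m) (n + 1) / (2 * (n : ℝ) + 1))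
      ∈ (1 / Real.pi) • (MtV (m + 2) : Set ℝ)) ∧
    (fun x : ℝ => (x : ℂ)) '' ((1 / Real.pi) • (MtV (m + 2) : Set ℝ))
      ⊆ (1 / (Real.pi : ℂ)) • (CMZV 2 (m + 2) : Set ℂ) := by
  have hconv := tsum_coeff_convTerm m
  have hbinom := tsum_coeff_binomTerm m
  simp only [coeff_binomTerm] at hbinom
  rw [sum_tsum_eq_tsum_coeff_convTerm, sum_admissible_by_length m fun s => tValue s.blocks, hbinom,
    hconv]
  refine ⟨?_, fun k hk => summable_convTerm_summand hk, fun s hs => tendsto_tSum_tValue s hs,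
    rfl, rfl, ?_, ?_⟩
  · refine (summable_coeff_binomTerm m).congr fun n => ?_
    rw [coeff_binomTerm]
  · refine ⟨4 * ∑ s : Composition (m + 2) with AdmissibleIndex s.blocks,
      (2 : ℝ) ^ (s.blocks.length - 1) * tValue s.blocks, ?_, ?_⟩
    · rw [Finset.mul_sum]
      refine Submodule.sum_mem _ fun s hs => ?_
      have hs' := (Finset.mem_filter.1 hs).2
      have h : 4 * ((2 : ℝ) ^ (s.blocks.length - 1) * tValue s.blocks) =
          (4 * 2 ^ (s.blocks.length - 1) : ℚ) • tValue s.blocks := by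
        rw [Rat.smul_def]
        push_cast
        ring
      rw [h]
      exact Submodule.smul_mem _ _
        (Submodule.subset_span ⟨s, hs', tendsto_tSum_tValue s hs'⟩)
    · simp only [smul_eq_mul]
      ring
  · rintro _ ⟨_, ⟨x, hx, rfl⟩, rfl⟩
    refine ⟨(x : ℂ), ofReal_mem_CMZV_of_mem_MtV hx, ?_⟩
    simp
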